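/- **Setting.** Let $d\ge 1$, let $\mathcal D_0=\mathcal D(\mathbb R^d)$ be the space of complex-valued test functions, and for $\varphi\in\mathcal D_0$ let $R_\varphi=\sup\{\|x\| : \varphi(x)\neq 0\}$ if $\varphi\ne 0$ and $R_\varphi=1$ if $\varphi=0$. For $n\ge 1$ let $\mathcal D_n$ be the set of all real-valued $\varphi\in\mathcal D_0$ such that $\varphi(-x)=\varphi(x)$ for all $x$, $R_\varphi\le 1/n$, $\int\varphi=1$, $\int x^\alpha\varphi(x)\,dx=0$ for $1\le|\alpha|\le n$, $\int|\varphi|\le 1+1/n$, and $\sup_x|\partial^\alpha\varphi(x)|\le R_\varphi^{-2(|\alpha|+d)}$ for $|\alpha|\le n$. Let $\mathcal U$ be any ultrafilter on $\mathcal D_0$ with $\mathcal D_n\in\mathcal U$ for all $n\ge 0$; "a.e." means "for all $\varphi$ in some member of $\mathcal U$". For $\mathbb K\in\{\mathbb R,\mathbb C\}$ the ring of asymptotic numbers $\widehat{\mathbb K^{\mathcal D_0}}$ is the ring of moderate nets $(A_\varphi)_{\varphi\in\mathcal D_0}$ in $\mathbb K$ (there is $m$ with $|A_\varphi|\le R_\varphi^{-m}$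 a.e.) modulo the negligible ones ($|A_\varphi|<R_\varphi^p$ a.e., for every $p$). A real asymptotic number is positive if it is nonzero and has a representative with $A_\varphi>0$ a.e.; a complex asymptotic number $z$, the class of $(A_\varphi)$, is infinitesimal, $z\approx 0$, if $|z|<1/n$ for all $n\ge 1$, where $|z|$ is the class of $(|A_\varphi|)$. Let $\Omega\subseteq\mathbb R^d$ be open and $\mathcal E(\Omega)=C^\infty(\Omega)$. The ring of asymptotic functions $\widehat{\mathcal E(\Omega)^{\mathcal D_0}}$ is the ring of moderate nets $(f_\varphi)$ in $\mathcal E(\Omega)$ (for all compact $K\subset\Omega$ and all multi-indices $\alpha$ there is $m$ with $\sup_K|\partial^\alpha f_\varphi|\le R_\varphi^{-m}$ a.e.) modulo the negligible ones ($\sup_K|\partial^\alpha f_\varphi|\le R_\varphi^{p}$ a.e., for all $K,\alpha,p$). The pairing of the class of $(f_\varphi)$ with $\tau\in\mathcal D(\Omega)$ is the class of $\left(\int_\Omega f_\varphi\tau\,dx\right)$ in $\widehat{\mathbb C^{\mathcal D_0}}$. For $T\in\mathcal D'(\Omega)$ let $(T\circledast\varphi)(x)=\big(T(t)\,\big|\,C_{\Omega,\varphi}(t)\,\varphi(x-t)\big)$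 for $x\in\Omega$, where $C_{\Omega,\varphi}$ is the convolution of $\varphi$ with the characteristic function of $\{x\in\Omega : d(x,\partial\Omega)>2R_\varphi,\ \|x\|<1/R_\varphi\}$ (with $d(x,\varnothing)=\infty$). **Theorem 5.4 (Weak Preservation).** For every $T\in\mathcal D'(\Omega)$ the net $(T\circledast\varphi)$ is a moderate net in $\mathcal E(\Omega)$, so that its class $E_\Omega(T)\in\widehat{\mathcal E(\Omega)^{\mathcal D_0}}$ is defined; for a continuous function $g$ on $\Omega$ write $E_\Omega(g)$ for $E_\Omega(T_g)$, where $(T_g|\tau)=\int_\Omega g\tau\,dx$. Let $T\in\mathcal D'(\Omega)$, let $f\in\mathcal E(\Omega)$, and let $g,h:\Omega\to\mathbb C$ be continuous. Then: (i) $E_\Omega(f)E_\Omega(T)\cong E_\Omega(fT)$, that is, $\big(E_\Omega(f)E_\Omega(T)\,\big|\,\tau\big)=\big(E_\Omega(fT)\,\big|\,\tau\big)$ in $\widehat{\mathbb C^{\mathcal D_0}}$ for all $\tau\in\mathcal D(\Omega)$, where $(fT|\tau)=(T|f\tau)$. (ii) $E_\Omega(g)E_\Omega(h)\approx E_\Omega(gh)$,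 that is, $\big(E_\Omega(g)E_\Omega(h)\,\big|\,\tau\big)-\big(E_\Omega(gh)\,\big|\,\tau\big)\approx 0$ for all $\tau\in\mathcal D(\Omega)$. -/

import Mathlib

open scoped Distributions ContDiff Topology
open MeasureTheory TopologicalSpace Filter

noncomputable section

namespace AsymptoticFunctions

/-! ### Test functions, radius of support, partial derivatives -/

/-- Euclidean space `ℝ^d`. -/
abbrev Vec (d : ℕ) : Type := EuclideanSpace ℝ (Fin d)

/-- `𝓓(ℝ^d)`: the complex valued test functions on `ℝ^d`; this is the index set of all nets. -/
abbrev TestSpace (d : ℕ) : Type := 𝓓((⊤ : Opens (Vec d)), ℂ)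

open Classical in
/-- The radius of support `R_φ = sup {‖x‖ : φ x ≠ 0}`, with `R_φ = 1` for `φ = 0`. -/
def suppRadius {d : ℕ} (φ : TestSpace d) : ℝ :=
  if φ = 0 then 1 else sSup {r : ℝ | ∃ x : Vec d, φ x ≠ 0 ∧ r = ‖x‖}

/-- The order `|α| = α₁ + ⋯ + α_d` of a multi-index. -/
def multiOrder {d : ℕ} (α : Fin d → ℕ) : ℕ := ∑ i, α i

/-- The partial derivative `∂_{β₁} ∂_{β₂} ⋯ ∂_{β_k} f` of order `k` in the coordinate directions
`β₁, …, β_k`. For smooth `f` it is `∂^α f`, where `α i` is the number of the `j` with `β j = i`, so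
that "for all `β : Fin k → Fin d`" means "for all multi-indices `α` with `|α| = k`". -/
def partialDeriv {d k : ℕ} (β : Fin k → Fin d) (f : Vec d → ℂ) (x : Vec d) : ℂ :=
  iteratedFDeriv ℝ k f x (fun j => EuclideanSpace.single (β j) (1 : ℝ))

/-- The monomial `x^α`. -/
def monomial {d : ℕ} (α : Fin d → ℕ) (x : Vec d) : ℝ := ∏ i, x i ^ α i

/-- The directing sequence `𝓓₀ ⊇ 𝓓₁ ⊇ 𝓓₂ ⊇ ⋯` of sets of test functions, with
`𝓓₀ = 𝓓(ℝ^d)`. -/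
def directingSet (d : ℕ) : ℕ → Set (TestSpace d)
  | 0 => Set.univ
  | n + 1 =>
    {φ | (∀ x, (φ x).im = 0) ∧
      (∀ x, φ (-x) = φ x) ∧
      suppRadius φ ≤ 1 / ((n + 1 : ℕ) : ℝ) ∧
      ∫ x, φ x = 1 ∧
      (∀ α : Fin d → ℕ, 1 ≤ multiOrder α → multiOrder α ≤ n + 1 →
        ∫ x, (monomial α x : ℂ) * φ x = 0) ∧
      ∫ x, ‖φ x‖ ≤ 1 + 1 / ((n + 1 : ℕ) : ℝ) ∧
      (∀ k ≤ n + 1, ∀ β : Fin k → Fin d,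
        ∀ x, ‖partialDeriv β φ x‖ ≤ (suppRadius φ ^ (2 * (k + d)))⁻¹)}

/-- Ultrafilters on the test functions that contain every directing set. A property of test
functions holds almost everywhere if the set of its solutions belongs to the ultrafilter. -/
structure DirectingUltrafilter (d : ℕ) where
  /-- The underlying ultrafilter. -/
  toUltrafilter : Ultrafilter (TestSpace d)
  directingSet_mem : ∀ n, directingSet d n ∈ toUltrafilter

/-- The filter of the sets of full measure, so that `∀ᶠ φ in U.ae, P φ` is "`P φ` a.e.". -/
abbrev DirectingUltrafilter.ae {d : ℕ} (U : DirectingUltrafilter d) : Filter (TestSpace d) :=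
  (U.toUltrafilter : Filter (TestSpace d))

theorem suppRadius_bddAbove {d : ℕ} (φ : TestSpace d) :
    BddAbove {r : ℝ | ∃ x : Vec d, φ x ≠ 0 ∧ r = ‖x‖} := by
  obtain ⟨C, hC⟩ := φ.hasCompactSupport.isCompact.isBounded.exists_norm_le
  refine ⟨C, ?_⟩
  rintro r ⟨x, hx, rfl⟩
  exact hC x (subset_tsupport _ hx)

theorem norm_le_suppRadius {d : ℕ} (φ : TestSpace d) {x : Vec d} (hx : φ x ≠ 0) :
    ‖x‖ ≤ suppRadius φ := by
  have h0 : φ ≠ 0 := by rintro rfl; exact hx rfl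
  rw [suppRadius, if_neg h0]
  exact le_csSup (suppRadius_bddAbove φ) ⟨x, hx, rfl⟩

theorem suppRadius_pos {d : ℕ} [NeZero d] (φ : TestSpace d) : 0 < suppRadius φ := by
  by_cases h0 : φ = 0
  · simp [suppRadius, h0]
  obtain ⟨x, hx⟩ : ∃ x, φ x ≠ 0 := by
    by_contra! h
    exact h0 (TestFunction.ext h)
  have hopen : IsOpen {y : Vec d | φ y ≠ 0} := isOpen_ne_fun φ.continuous continuous_const
  obtain ⟨y, hy, hy0⟩ : ∃ y, φ y ≠ 0 ∧ y ≠ 0 := by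
    by_cases hx0 : x = 0
    · have hn : {y : Vec d | φ y ≠ 0} ∈ 𝓝 x := hopen.mem_nhds hx
      have : (𝓝[≠] x).NeBot := inferInstance
      obtain ⟨y, hy1, hy2⟩ := this.nonempty_of_mem
        (inter_mem (mem_nhdsWithin_of_mem_nhds hn) self_mem_nhdsWithin)
      exact ⟨y, hy1, by simpa [hx0] using hy2⟩
    · exact ⟨x, hx, hx0⟩
  exact (norm_pos_iff.2 hy0).trans_le (norm_le_suppRadius φ hy)

theorem DirectingUltrafilter.eventually_mem {d : ℕ} (U : DirectingUltrafilter d) (n : ℕ) :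
    ∀ᶠ φ in U.ae, φ ∈ directingSet d n := U.directingSet_mem n

theorem eventually_le {d : ℕ} (U : DirectingUltrafilter d) (n : ℕ) :
    ∀ᶠ φ in U.ae, suppRadius φ ≤ 1 / ((n + 1 : ℕ) : ℝ) := by
  filter_upwards [U.eventually_mem (n + 1)] with φ hφ
  exact hφ.2.2.1

theorem eventually_le_one {d : ℕ} (U : DirectingUltrafilter d) :
    ∀ᶠ φ in U.ae, suppRadius φ ≤ 1 := by
  filter_upwards [eventually_le U 0] with φ hφ
  simpa using hφ

theorem eventually_const_mul_le {d : ℕ} (U : DirectingUltrafilter d) (C : ℝ) :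
    ∀ᶠ φ in U.ae, C * suppRadius φ < 1 ∨ suppRadius φ ≤ 0 := by
  obtain ⟨n, hn⟩ := exists_nat_gt C
  filter_upwards [eventually_le U n] with φ hφ
  by_cases h0 : suppRadius φ ≤ 0
  · exact Or.inr h0
  left
  push Not at h0
  have hn' : C < ((n + 1 : ℕ) : ℝ) := by push_cast; linarith
  have hp : (0 : ℝ) < ((n + 1 : ℕ) : ℝ) := by positivity
  calc C * suppRadius φ < ((n + 1 : ℕ) : ℝ) * suppRadius φ := by gcongr
    _ ≤ ((n + 1 : ℕ) : ℝ) * (1 / ((n + 1 : ℕ) : ℝ)) := by gcongr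
    _ = 1 := by field_simp

/-- Growth of constants times negative powers of the radius. -/
theorem eventually_const_mul_inv_pow_le {d : ℕ} [NeZero d] (U : DirectingUltrafilter d) (C : ℝ)
    (m : ℕ) : ∀ᶠ φ in U.ae,
      C * (suppRadius φ ^ m)⁻¹ ≤ (suppRadius φ ^ (m + 1))⁻¹ := by
  filter_upwards [eventually_const_mul_le U C] with φ hφ
  have hp := suppRadius_pos φ
  have h := hφ.resolve_right (not_le.2 hp)
  rw [pow_succ, mul_inv, mul_comm C]
  gcongr
  rw [← one_div, le_div_iff₀ hp]
  exact h.le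

theorem eventually_const_mul_pow_lt {d : ℕ} [NeZero d] (U : DirectingUltrafilter d) (C : ℝ)
    (m : ℕ) : ∀ᶠ φ in U.ae, C * suppRadius φ ^ (m + 1) < suppRadius φ ^ m := by
  filter_upwards [eventually_const_mul_le U C] with φ hφ
  have hp := suppRadius_pos φ
  have h := hφ.resolve_right (not_le.2 hp)
  calc C * suppRadius φ ^ (m + 1) = suppRadius φ ^ m * (C * suppRadius φ) := by ring
    _ < suppRadius φ ^ m * 1 := by gcongr
    _ = _ := mul_one _

theorem inv_pow_le_inv_pow {d : ℕ} [NeZero d] {φ : TestSpace d} (h1 : suppRadius φ ≤ 1)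
    {m n : ℕ} (h : m ≤ n) : (suppRadius φ ^ m)⁻¹ ≤ (suppRadius φ ^ n)⁻¹ := by
  have hp := suppRadius_pos φ
  exact inv_anti₀ (by positivity) (pow_le_pow_of_le_one hp.le h1 h)

/-! ### Asymptotic numbers -/

section Numbers

variable {d : ℕ} [NeZero d] (U : DirectingUltrafilter d) (𝕜 : Type) [RCLike 𝕜]

/-- The ring of moderate nets in `𝕜` (`𝕜 = ℝ` or `ℂ`): `|A_φ| ≤ R_φ^{-m}` a.e. for some `m`. -/
def moderateNumbers : Subring (TestSpace d → 𝕜) where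
  carrier := {A | ∃ m : ℕ, ∀ᶠ φ in U.ae, ‖A φ‖ ≤ (suppRadius φ ^ m)⁻¹}
  zero_mem' := ⟨0, by simp⟩
  one_mem' := ⟨0, by simp⟩
  neg_mem' := by rintro A ⟨m, hm⟩; exact ⟨m, by simpa using hm⟩
  add_mem' := by
    rintro A B ⟨m, hm⟩ ⟨n, hn⟩
    refine ⟨max m n + 1, ?_⟩
    filter_upwards [hm, hn, eventually_const_mul_inv_pow_le U 2 (max m n), eventually_le_one U]
      with φ h1 h2 h3 h4
    have e1 := inv_pow_le_inv_pow h4 (le_max_left m n)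
    have e2 := inv_pow_le_inv_pow h4 (le_max_right m n)
    calc ‖A φ + B φ‖ ≤ ‖A φ‖ + ‖B φ‖ := norm_add_le _ _
      _ ≤ 2 * (suppRadius φ ^ max m n)⁻¹ := by linarith
      _ ≤ _ := h3
  mul_mem' := by
    rintro A B ⟨m, hm⟩ ⟨n, hn⟩
    refine ⟨m + n, ?_⟩
    filter_upwards [hm, hn] with φ h1 h2
    have hp := suppRadius_pos φ
    calc ‖A φ * B φ‖ = ‖A φ‖ * ‖B φ‖ := norm_mul _ _
      _ ≤ (suppRadius φ ^ m)⁻¹ * (suppRadius φ ^ n)⁻¹ := by gcongr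
      _ = _ := by rw [pow_add, mul_inv]

/-- The ideal of negligible nets in `𝕜`: `|A_φ| < R_φ^p` a.e. for all `p`. -/
def negligibleNumbers : Ideal (moderateNumbers U 𝕜) where
  carrier := {A | ∀ p : ℕ, ∀ᶠ φ in U.ae, ‖A.1 φ‖ < suppRadius φ ^ p}
  zero_mem' := by
    intro p
    filter_upwards with φ
    have hp := suppRadius_pos φ
    simpa using pow_pos hp p
  add_mem' := by
    intro A B hA hB p
    filter_upwards [hA (p + 1), hB (p + 1), eventually_const_mul_pow_lt U 2 p] with φ h1 h2 h3
    calc ‖A.1 φ + B.1 φ‖ ≤ ‖A.1 φ‖ + ‖B.1 φ‖ := norm_add_le _ _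
      _ < _ := by linarith
  smul_mem' := by
    rintro ⟨A, m, hm⟩ B hB p
    filter_upwards [hm, hB (p + m)] with φ h1 h2
    have hp := suppRadius_pos φ
    calc ‖A φ * B.1 φ‖ = ‖A φ‖ * ‖B.1 φ‖ := norm_mul _ _
      _ ≤ (suppRadius φ ^ m)⁻¹ * ‖B.1 φ‖ := by gcongr
      _ < (suppRadius φ ^ m)⁻¹ * suppRadius φ ^ (p + m) := by gcongr
      _ = _ := by rw [pow_add]; field_simp

/-- The ring of asymptotic numbers: moderate nets modulo negligible nets. The complex asymptotic
numbers are the case `𝕜 = ℂ` and the real asymptotic numbers are the case `𝕜 = ℝ`. -/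
abbrev AsymptoticNumber : Type := moderateNumbers U 𝕜 ⧸ negligibleNumbers U 𝕜

/-- The class of the constant net with value `c`. -/
def AsymptoticNumber.const (c : 𝕜) : AsymptoticNumber U 𝕜 :=
  Ideal.Quotient.mk (negligibleNumbers U 𝕜) ⟨fun _ => c, by
    refine ⟨1, ?_⟩
    filter_upwards [eventually_const_mul_inv_pow_le U ‖c‖ 0] with φ h
    simpa using h⟩

variable {U 𝕜}

/-- A real asymptotic number is positive if it is nonzero and has a representative `A` with
`A_φ > 0` a.e. -/
def AsymptoticNumber.IsPos (a : AsymptoticNumber U ℝ) : Prop :=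
  a ≠ 0 ∧ ∃ A : moderateNumbers U ℝ, Ideal.Quotient.mk (negligibleNumbers U ℝ) A = a ∧
    ∀ᶠ φ in U.ae, 0 < A.1 φ

/-- The strict order on the real asymptotic numbers. -/
def AsymptoticNumber.Lt (a b : AsymptoticNumber U ℝ) : Prop := (b - a).IsPos

/-- The absolute value of a complex asymptotic number, a real asymptotic number: the class of
`(|A_φ|)`. -/
def AsymptoticNumber.abs : AsymptoticNumber U ℂ → AsymptoticNumber U ℝ :=
  Quotient.map'
    (fun A => (⟨fun φ => ‖A.1 φ‖, by
      obtain ⟨m, hm⟩ := A.2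
      exact ⟨m, by simpa using hm⟩⟩ : moderateNumbers U ℝ))
    (by
      intro A B h
      rw [Submodule.quotientRel_def] at h ⊢
      intro p
      filter_upwards [h p] with φ hφ
      exact (abs_norm_sub_norm_le (A.1 φ) (B.1 φ)).trans_lt hφ)

/-- `z ≈ 0`: the absolute value of `z` is smaller than `1 / n` for every positive integer `n`. -/
def AsymptoticNumber.IsInfinitesimal (z : AsymptoticNumber U ℂ) : Prop :=
  ∀ n : ℕ, 0 < n → AsymptoticNumber.Lt z.abs (AsymptoticNumber.const U ℝ (1 / (n : ℝ)))

end Numbers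

/-! ### Smooth functions and nets of smooth functions -/

section Functions

variable {d : ℕ}

open Classical in
/-- Extension by zero of a function on `Ω` to `ℝ^d`. -/
def extendZero {Ω : Opens (Vec d)} (f : Ω → ℂ) (x : Vec d) : ℂ :=
  if h : x ∈ Ω then f ⟨x, h⟩ else 0

theorem extendZero_coe {Ω : Opens (Vec d)} (f : Ω → ℂ) (x : Ω) : extendZero f x = f x := by
  simp [extendZero]

theorem extendZero_of_mem {Ω : Opens (Vec d)} (f : Ω → ℂ) {x : Vec d} (hx : x ∈ Ω) :
    extendZero f x = f ⟨x, hx⟩ := by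
  simp [extendZero, hx]

theorem extendZero_add {Ω : Opens (Vec d)} (f g : Ω → ℂ) :
    extendZero (f + g) = extendZero f + extendZero g := by
  funext x; by_cases h : x ∈ Ω <;> simp [extendZero, h]

theorem extendZero_sub {Ω : Opens (Vec d)} (f g : Ω → ℂ) :
    extendZero (f - g) = extendZero f - extendZero g := by
  funext x; by_cases h : x ∈ Ω <;> simp [extendZero, h]

theorem extendZero_neg {Ω : Opens (Vec d)} (f : Ω → ℂ) :
    extendZero (-f) = -extendZero f := by
  funext x; by_cases h : x ∈ Ω <;> simp [extendZero, h]

theorem extendZero_mul {Ω : Opens (Vec d)} (f g : Ω → ℂ) :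
    extendZero (f * g) = extendZero f * extendZero g := by
  funext x; by_cases h : x ∈ Ω <;> simp [extendZero, h]

theorem extendZero_zero {Ω : Opens (Vec d)} : extendZero (0 : Ω → ℂ) = 0 := by
  funext x; by_cases h : x ∈ Ω <;> simp [extendZero, h]

theorem extendZero_one_eventuallyEq {Ω : Opens (Vec d)} {x : Vec d} (hx : x ∈ Ω) :
    extendZero (1 : Ω → ℂ) =ᶠ[𝓝 x] fun _ => (1 : ℂ) := by
  filter_upwards [Ω.isOpen.mem_nhds hx] with y hy
  simp [extendZero_of_mem _ hy]

variable (Ω : Opens (Vec d))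

/-- `𝓔(Ω) = C^∞(Ω)`: the ring of complex valued functions on `Ω` that are infinitely often
differentiable. -/
def smoothFunctions : Subring (Ω → ℂ) where
  carrier := {f | ContDiffOn ℝ ∞ (extendZero f) Ω}
  zero_mem' := by
    change ContDiffOn ℝ ∞ (extendZero (0 : Ω → ℂ)) Ω
    rw [extendZero_zero]; exact contDiffOn_const
  one_mem' := by
    change ContDiffOn ℝ ∞ (extendZero (1 : Ω → ℂ)) Ω
    exact contDiffOn_const.congr (fun x hx => (extendZero_one_eventuallyEq hx).self_of_nhds)
  neg_mem' := by
    intro f hf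
    change ContDiffOn ℝ ∞ (extendZero (-f)) Ω
    rw [extendZero_neg]; exact hf.neg
  add_mem' := by
    intro f g hf hg
    change ContDiffOn ℝ ∞ (extendZero (f + g)) Ω
    rw [extendZero_add]; exact hf.add hg
  mul_mem' := by
    intro f g hf hg
    change ContDiffOn ℝ ∞ (extendZero (f * g)) Ω
    rw [extendZero_mul]; exact hf.mul hg

/-- Nets of smooth functions on `Ω`. -/
abbrev SmoothNet : Type := TestSpace d → smoothFunctions Ω

variable {Ω}

theorem contDiffAt_extendZero (f : smoothFunctions Ω) {x : Vec d} (hx : x ∈ Ω) :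
    ContDiffAt ℝ ∞ (extendZero f.1) x :=
  (f.2 : ContDiffOn ℝ ∞ (extendZero f.1) Ω).contDiffAt (Ω.isOpen.mem_nhds hx)

theorem partialDeriv_zero (β : Fin 0 → Fin d) (f : Vec d → ℂ) (x : Vec d) :
    partialDeriv β f x = f x := by
  simp [partialDeriv]

theorem norm_partialDeriv_le {k : ℕ} (β : Fin k → Fin d) (f : Vec d → ℂ) (x : Vec d) :
    ‖partialDeriv β f x‖ ≤ ‖iteratedFDeriv ℝ k f x‖ := by
  refine (ContinuousMultilinearMap.le_opNorm _ _).trans ?_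
  simp

theorem norm_iteratedFDeriv_le_sum (f : Vec d → ℂ) (x : Vec d) (k : ℕ) :
    ‖iteratedFDeriv ℝ k f x‖ ≤ ∑ β : Fin k → Fin d, ‖partialDeriv β f x‖ := by
  refine ContinuousMultilinearMap.opNorm_le_bound (Finset.sum_nonneg fun _ _ => norm_nonneg _) ?_
  intro v
  have hv : v = fun j => ∑ i, v j i • EuclideanSpace.single i (1 : ℝ) := by
    funext j
    ext i
    simp [Pi.single_apply]
  have hs : iteratedFDeriv ℝ k f x v = ∑ β : Fin k → Fin d,
      iteratedFDeriv ℝ k f x fun j => v j (β j) • EuclideanSpace.single (β j) (1 : ℝ) := by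
    conv_lhs => rw [hv]
    exact ContinuousMultilinearMap.map_sum _ _
  rw [hs]
  refine (norm_sum_le _ _).trans ?_
  rw [Finset.sum_mul]
  refine Finset.sum_le_sum fun β _ => ?_
  rw [ContinuousMultilinearMap.map_smul_univ, norm_smul, mul_comm]
  refine mul_le_mul_of_nonneg_left ?_ (norm_nonneg _)
  rw [norm_prod]
  exact Finset.prod_le_prod (fun _ _ => norm_nonneg _) fun j _ => PiLp.norm_apply_le _ _

theorem norm_iteratedFDeriv_mul_le_sum (f g : smoothFunctions Ω) {x : Vec d} (hx : x ∈ Ω) (k : ℕ) :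
    ‖iteratedFDeriv ℝ k (extendZero (f * g).1) x‖ ≤
      ∑ i ∈ Finset.range (k + 1), (k.choose i : ℝ) *
        ‖iteratedFDeriv ℝ i (extendZero f.1) x‖ * ‖iteratedFDeriv ℝ (k - i) (extendZero g.1) x‖ := by
  have h := norm_iteratedFDerivWithin_mul_le (𝕜 := ℝ) (f := extendZero f.1) (g := extendZero g.1)
    (s := (Ω : Set (Vec d))) (N := ∞) f.2 g.2 Ω.isOpen.uniqueDiffOn hx (n := k) (mod_cast le_top)
  simp only [iteratedFDerivWithin_of_isOpen _ Ω.isOpen hx] at h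
  have e : extendZero (f * g).1 = fun y => extendZero f.1 y * extendZero g.1 y :=
    extendZero_mul f.1 g.1
  rw [e]
  exact h

theorem partialDeriv_extendZero_add (f g : smoothFunctions Ω) {x : Vec d} (hx : x ∈ Ω) {k : ℕ}
    (β : Fin k → Fin d) : partialDeriv β (extendZero (f + g).1) x =
      partialDeriv β (extendZero f.1) x + partialDeriv β (extendZero g.1) x := by
  have e : extendZero (f + g).1 = extendZero f.1 + extendZero g.1 := extendZero_add f.1 g.1
  rw [partialDeriv, e, iteratedFDeriv_add_apply ((contDiffAt_extendZero f hx).of_le (mod_cast le_top))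
    ((contDiffAt_extendZero g hx).of_le (mod_cast le_top))]
  rfl

theorem partialDeriv_extendZero_zero {x : Vec d} {k : ℕ} (β : Fin k → Fin d) :
    partialDeriv β (extendZero (0 : Ω → ℂ)) x = 0 := by
  rw [extendZero_zero, partialDeriv]
  simp

theorem mul_bound {k : ℕ} {a b : ℕ → ℝ} {A B : ℝ} (ha0 : ∀ i ≤ k, 0 ≤ a i)
    (hb0 : ∀ i ≤ k, 0 ≤ b i) (ha : ∀ i ≤ k, a i ≤ A) (hb : ∀ i ≤ k, b i ≤ B) :
    ∑ i ∈ Finset.range (k + 1), (k.choose i : ℝ) * a i * b (k - i) ≤ 2 ^ k * (A * B) := by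
  have h : ∀ i ∈ Finset.range (k + 1),
      (k.choose i : ℝ) * a i * b (k - i) ≤ (k.choose i : ℝ) * (A * B) := by
    intro i hi
    have hi' : i ≤ k := by simpa [Nat.lt_succ_iff] using hi
    rw [mul_assoc]
    gcongr
    · exact hb0 _ (Nat.sub_le _ _)
    · exact (ha0 i hi').trans (ha i hi')
    · exact ha i hi'
    · exact hb _ (Nat.sub_le _ _)
  refine (Finset.sum_le_sum h).trans_eq ?_
  rw [← Finset.sum_mul, ← Nat.cast_sum, Nat.sum_range_choose]
  push_cast
  rfl

/-- The pairing `(f | τ) = ∫_Ω f τ` of a function on `Ω` with a test function. -/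
def pairing (f : Ω → ℂ) (τ : 𝓓(Ω, ℂ)) : ℂ := ∫ x in (Ω : Set (Vec d)), extendZero f x * τ x

theorem integrableOn_extendZero_mul (f : smoothFunctions Ω) (τ : 𝓓(Ω, ℂ)) :
    IntegrableOn (fun x => extendZero f.1 x * τ x) (Ω : Set (Vec d)) := by
  have hc : ContinuousOn (extendZero f.1) (Ω : Set (Vec d)) :=
    (f.2 : ContDiffOn ℝ ∞ (extendZero f.1) Ω).continuousOn
  have h := τ.integrable_bilin (𝕜 := ℂ) ((ContinuousLinearMap.mul ℂ ℂ).flip)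
    (hc.locallyIntegrableOn (μ := volume) Ω.isOpen.measurableSet)
  exact h.integrableOn

theorem norm_pairing_le {f : Ω → ℂ} (τ : 𝓓(Ω, ℂ)) {C : ℝ} (hC : ∀ x ∈ tsupport τ,
    ‖extendZero f x‖ ≤ C) : ‖pairing f τ‖ ≤ C * ∫ x in (Ω : Set (Vec d)), ‖τ x‖ := by
  rw [pairing, ← integral_const_mul]
  have hi : Integrable (τ : Vec d → ℂ) := τ.continuous.integrable_of_hasCompactSupport
    τ.hasCompactSupport
  refine norm_integral_le_of_norm_le (hi.norm.const_mul C).integrableOn ?_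
  filter_upwards with x
  rw [norm_mul]
  by_cases hx : τ x = 0
  · simp [hx]
  · gcongr
    exact hC x (subset_tsupport _ hx)

end Functions

/-! ### Asymptotic functions -/

section AsymptoticFunctions

variable {d : ℕ} [NeZero d] (U : DirectingUltrafilter d) (Ω : Opens (Vec d))

/-- A net `(F_φ)` of functions on `Ω` is a moderate net in `𝓔(Ω)` if every `F_φ` is smooth and
every partial derivative is a.e. bounded by some `R_φ^{-m}` on every compact subset of `Ω`. -/
def IsModerate (F : TestSpace d → Ω → ℂ) : Prop :=
  (∀ φ, F φ ∈ smoothFunctions Ω) ∧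
  ∀ K : Set (Vec d), IsCompact K → K ⊆ Ω → ∀ (k : ℕ) (β : Fin k → Fin d), ∃ m : ℕ,
    ∀ᶠ φ in U.ae, ∀ x ∈ K, ‖partialDeriv β (extendZero (F φ)) x‖ ≤ (suppRadius φ ^ m)⁻¹

/-- A net of functions is negligible if every partial derivative is, for every `p`, a.e. bounded by
`R_φ^p` on every compact subset of `Ω`. -/
def IsNegligible (F : TestSpace d → Ω → ℂ) : Prop :=
  ∀ K : Set (Vec d), IsCompact K → K ⊆ Ω → ∀ (k : ℕ) (β : Fin k → Fin d), ∀ p : ℕ,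
    ∀ᶠ φ in U.ae, ∀ x ∈ K, ‖partialDeriv β (extendZero (F φ)) x‖ ≤ suppRadius φ ^ p

variable {U Ω}

theorem IsModerate.norm_iteratedFDeriv_le {F : TestSpace d → Ω → ℂ} (hF : IsModerate U Ω F)
    {K : Set (Vec d)} (hK : IsCompact K) (hKΩ : K ⊆ Ω) (k : ℕ) : ∃ m : ℕ,
    ∀ᶠ φ in U.ae, ∀ n ≥ m, ∀ x ∈ K,
      ‖iteratedFDeriv ℝ k (extendZero (F φ)) x‖ ≤ (suppRadius φ ^ n)⁻¹ := by
  choose m hm using hF.2 K hK hKΩ k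
  refine ⟨(∑ β, m β) + 1, ?_⟩
  filter_upwards [eventually_all.2 hm, eventually_le_one U,
    eventually_const_mul_inv_pow_le U (Fintype.card (Fin k → Fin d)) (∑ β, m β)]
    with φ h1 h2 h3 n hn x hx
  calc ‖iteratedFDeriv ℝ k (extendZero (F φ)) x‖
      ≤ ∑ β : Fin k → Fin d, ‖partialDeriv β (extendZero (F φ)) x‖ :=
        norm_iteratedFDeriv_le_sum _ _ _
    _ ≤ ∑ _β : Fin k → Fin d, (suppRadius φ ^ (∑ β, m β))⁻¹ := by
        refine Finset.sum_le_sum fun β _ => (h1 β x hx).trans (inv_pow_le_inv_pow h2 ?_)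
        exact Finset.single_le_sum (f := m) (fun _ _ => Nat.zero_le _) (Finset.mem_univ β)
    _ = (Fintype.card (Fin k → Fin d) : ℝ) * (suppRadius φ ^ (∑ β, m β))⁻¹ := by
        rw [Finset.sum_const, nsmul_eq_mul]; rfl
    _ ≤ _ := h3
    _ ≤ _ := inv_pow_le_inv_pow h2 hn

theorem IsNegligible.norm_iteratedFDeriv_le {F : TestSpace d → Ω → ℂ} (hF : IsNegligible U Ω F)
    {K : Set (Vec d)} (hK : IsCompact K) (hKΩ : K ⊆ Ω) (k p : ℕ) :
    ∀ᶠ φ in U.ae, ∀ x ∈ K,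
      ‖iteratedFDeriv ℝ k (extendZero (F φ)) x‖ ≤ suppRadius φ ^ p := by
  filter_upwards [eventually_all.2 fun β => hF K hK hKΩ k β (p + 1),
    eventually_const_mul_pow_lt U (Fintype.card (Fin k → Fin d)) p] with φ h1 h2 x hx
  calc ‖iteratedFDeriv ℝ k (extendZero (F φ)) x‖
      ≤ ∑ β : Fin k → Fin d, ‖partialDeriv β (extendZero (F φ)) x‖ :=
        norm_iteratedFDeriv_le_sum _ _ _
    _ ≤ ∑ _β : Fin k → Fin d, suppRadius φ ^ (p + 1) := Finset.sum_le_sum fun β _ => h1 β x hx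
    _ = (Fintype.card (Fin k → Fin d) : ℝ) * suppRadius φ ^ (p + 1) := by
        rw [Finset.sum_const, nsmul_eq_mul]; rfl
    _ ≤ _ := h2.le

theorem isModerate_one : IsModerate U Ω (fun _ => 1) := by
  refine ⟨fun _ => one_mem _, fun K hK hKΩ k β => ⟨0, ?_⟩⟩
  filter_upwards with φ x hx
  have h : iteratedFDeriv ℝ k (extendZero (1 : Ω → ℂ)) x
      = iteratedFDeriv ℝ k (fun _ => (1 : ℂ)) x :=
    ((extendZero_one_eventuallyEq (hKΩ hx)).iteratedFDeriv ℝ k).self_of_nhds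
  rw [partialDeriv, h]
  rcases Nat.eq_zero_or_pos k with rfl | hk
  · simp
  · rw [iteratedFDeriv_const_of_ne hk.ne']
    simp

variable (U Ω)

/-- The ring of moderate nets of smooth functions. -/
def moderateFunctions : Subring (SmoothNet Ω) where
  carrier := {F | IsModerate U Ω (fun φ => (F φ).1)}
  zero_mem' := by
    refine ⟨fun _ => zero_mem _, fun K hK hKΩ k β => ⟨0, ?_⟩⟩
    filter_upwards with φ x hx
    have := partialDeriv_extendZero_zero (Ω := Ω) (x := x) β
    change ‖partialDeriv β (extendZero (0 : Ω → ℂ)) x‖ ≤ _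
    simp [this]
  one_mem' := isModerate_one
  neg_mem' := by
    intro F hF
    refine ⟨fun φ => (-F φ).2, fun K hK hKΩ k β => ?_⟩
    obtain ⟨m, hm⟩ := hF.2 K hK hKΩ k β
    refine ⟨m, ?_⟩
    filter_upwards [hm] with φ h x hx
    have e : extendZero (-(F φ).1) = -extendZero (F φ).1 := extendZero_neg _
    change ‖partialDeriv β (extendZero (-(F φ).1)) x‖ ≤ _
    rw [e, partialDeriv, iteratedFDeriv_neg_apply]
    simpa [partialDeriv] using h x hx
  add_mem' := by
    intro F G hF hG
    refine ⟨fun φ => (F φ + G φ).2, fun K hK hKΩ k β => ?_⟩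
    obtain ⟨m, hm⟩ := hF.2 K hK hKΩ k β
    obtain ⟨n, hn⟩ := hG.2 K hK hKΩ k β
    refine ⟨max m n + 1, ?_⟩
    filter_upwards [hm, hn, eventually_const_mul_inv_pow_le U 2 (max m n), eventually_le_one U]
      with φ h1 h2 h3 h4 x hx
    have e1 := inv_pow_le_inv_pow h4 (le_max_left m n)
    have e2 := inv_pow_le_inv_pow h4 (le_max_right m n)
    have e3 := h1 x hx
    have e4 := h2 x hx
    change ‖partialDeriv β (extendZero (F φ + G φ).1) x‖ ≤ _
    rw [partialDeriv_extendZero_add _ _ (hKΩ hx)]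
    refine (norm_add_le _ _).trans (le_trans ?_ h3)
    linarith
  mul_mem' := by
    intro F G hF hG
    refine ⟨fun φ => (F φ * G φ).2, fun K hK hKΩ k β => ?_⟩
    choose m hm using fun i => hF.norm_iteratedFDeriv_le hK hKΩ i
    choose n hn using fun i => hG.norm_iteratedFDeriv_le hK hKΩ i
    let M := ∑ i ∈ Finset.range (k + 1), m i
    let N := ∑ i ∈ Finset.range (k + 1), n i
    have hM : ∀ i ≤ k, m i ≤ M := fun i hi =>
      Finset.single_le_sum (f := m) (fun _ _ => Nat.zero_le _) (by simp; omega)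
    have hN : ∀ i ≤ k, n i ≤ N := fun i hi =>
      Finset.single_le_sum (f := n) (fun _ _ => Nat.zero_le _) (by simp; omega)
    refine ⟨M + N + 1, ?_⟩
    have hm' := (eventually_all_finite (Set.finite_Iic k)).2 fun i _ => hm i
    have hn' := (eventually_all_finite (Set.finite_Iic k)).2 fun i _ => hn i
    filter_upwards [hm', hn', eventually_const_mul_inv_pow_le U (2 ^ k) (M + N)]
      with φ h1 h2 h3 x hx
    refine (norm_partialDeriv_le _ _ _).trans ?_
    refine (norm_iteratedFDeriv_mul_le_sum (F φ) (G φ) (hKΩ hx) k).trans ?_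
    refine (mul_bound (A := (suppRadius φ ^ M)⁻¹) (B := (suppRadius φ ^ N)⁻¹)
      (a := fun i => ‖iteratedFDeriv ℝ i (extendZero (F φ).1) x‖)
      (b := fun i => ‖iteratedFDeriv ℝ i (extendZero (G φ).1) x‖)
      (fun i _ => norm_nonneg _) (fun i _ => norm_nonneg _)
      (fun i hi => h1 i hi M (hM i hi) x hx) (fun i hi => h2 i hi N (hN i hi) x hx)).trans ?_
    rw [← mul_inv, ← pow_add]
    exact h3

/-- The ideal of negligible nets of smooth functions. -/
def negligibleFunctions : Ideal (moderateFunctions U Ω) where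
  carrier := {F | IsNegligible U Ω (fun φ => (F.1 φ).1)}
  zero_mem' := by
    intro K hK hKΩ k β p
    filter_upwards with φ x hx
    have := partialDeriv_extendZero_zero (Ω := Ω) (x := x) β
    have hp := suppRadius_pos φ
    change ‖partialDeriv β (extendZero (0 : Ω → ℂ)) x‖ ≤ _
    rw [this, norm_zero]
    positivity
  add_mem' := by
    intro F G hF hG K hK hKΩ k β p
    filter_upwards [hF K hK hKΩ k β (p + 1), hG K hK hKΩ k β (p + 1),
      eventually_const_mul_pow_lt U 2 p] with φ h1 h2 h3 x hx
    have e3 := h1 x hx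
    have e4 := h2 x hx
    change ‖partialDeriv β (extendZero (F.1 φ + G.1 φ).1) x‖ ≤ _
    rw [partialDeriv_extendZero_add _ _ (hKΩ hx)]
    refine (norm_add_le _ _).trans ?_
    linarith
  smul_mem' := by
    intro F G hG K hK hKΩ k β p
    have hF : IsModerate U Ω (fun φ => (F.1 φ).1) := F.2
    have hG' : IsNegligible U Ω (fun φ => (G.1 φ).1) := hG
    choose m hm using fun i => hF.norm_iteratedFDeriv_le hK hKΩ i
    let M := ∑ i ∈ Finset.range (k + 1), m i
    have hM : ∀ i ≤ k, m i ≤ M := fun i hi =>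
      Finset.single_le_sum (f := m) (fun _ _ => Nat.zero_le _) (by simp; omega)
    have hm' := (eventually_all_finite (Set.finite_Iic k)).2 fun i _ => hm i
    have hn' := (eventually_all_finite (Set.finite_Iic k)).2 fun i _ =>
      hG'.norm_iteratedFDeriv_le hK hKΩ i (M + (p + 1))
    filter_upwards [hm', hn', eventually_const_mul_pow_lt U (2 ^ k) p] with φ h1 h2 h3 x hx
    have hp := suppRadius_pos φ
    refine (norm_partialDeriv_le _ _ _).trans ?_
    refine (norm_iteratedFDeriv_mul_le_sum (F.1 φ) (G.1 φ) (hKΩ hx) k).trans ?_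
    refine (mul_bound (A := (suppRadius φ ^ M)⁻¹) (B := suppRadius φ ^ (M + (p + 1)))
      (a := fun i => ‖iteratedFDeriv ℝ i (extendZero (F.1 φ).1) x‖)
      (b := fun i => ‖iteratedFDeriv ℝ i (extendZero (G.1 φ).1) x‖)
      (fun i _ => norm_nonneg _) (fun i _ => norm_nonneg _)
      (fun i hi => h1 i hi M (hM i hi) x hx) (fun i hi => h2 i hi x hx)).trans ?_
    have e : (suppRadius φ ^ M)⁻¹ * suppRadius φ ^ (M + (p + 1)) = suppRadius φ ^ (p + 1) := by
      rw [pow_add]; field_simp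
    rw [e]
    exact h3.le

/-- The ring of asymptotic functions on `Ω`: moderate nets modulo negligible nets. -/
abbrev AsymptoticFunction : Type := moderateFunctions U Ω ⧸ negligibleFunctions U Ω

variable {U Ω}

/-- The class of a moderate net. -/
def AsymptoticFunction.ofNet (F : TestSpace d → Ω → ℂ) (hF : IsModerate U Ω F) :
    AsymptoticFunction U Ω :=
  Ideal.Quotient.mk (negligibleFunctions U Ω) ⟨fun φ => ⟨F φ, hF.1 φ⟩, hF⟩

/-- The pairing of an asymptotic function with a test function, an asymptotic number: the class of
the net `(f_φ | τ)`. -/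
def AsymptoticFunction.pairing (τ : 𝓓(Ω, ℂ)) :
    AsymptoticFunction U Ω → AsymptoticNumber U ℂ :=
  Quotient.map'
    (fun F => (⟨fun φ => AsymptoticFunctions.pairing (F.1 φ).1 τ, by
      obtain ⟨m, hm⟩ := F.2.2 _ τ.hasCompactSupport τ.tsupport_subset 0 ![]
      refine ⟨m + 1, ?_⟩
      filter_upwards [hm, eventually_const_mul_inv_pow_le U
        (∫ x in (Ω : Set (Vec d)), ‖τ x‖) m] with φ h1 h2
      refine (norm_pairing_le τ fun x hx => ?_).trans ((mul_comm _ _).trans_le h2)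
      simpa [partialDeriv_zero] using h1 x hx⟩ : moderateNumbers U ℂ))
    (by
      intro F G h
      rw [Submodule.quotientRel_def] at h ⊢
      intro p
      have h' : IsNegligible U Ω (fun φ => ((F - G).1 φ).1) := h
      filter_upwards [h' _ τ.hasCompactSupport τ.tsupport_subset 0 ![] (p + 1),
        eventually_const_mul_pow_lt U (∫ x in (Ω : Set (Vec d)), ‖τ x‖) p] with φ h1 h2
      have e : AsymptoticFunctions.pairing (F.1 φ).1 τ - AsymptoticFunctions.pairing (G.1 φ).1 τ
          = AsymptoticFunctions.pairing ((F - G).1 φ).1 τ := by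
        rw [AsymptoticFunctions.pairing, AsymptoticFunctions.pairing, AsymptoticFunctions.pairing,
          ← integral_sub (integrableOn_extendZero_mul _ _) (integrableOn_extendZero_mul _ _)]
        have e' : extendZero ((F - G).1 φ).1 = extendZero (F.1 φ).1 - extendZero (G.1 φ).1 :=
          extendZero_sub _ _
        rw [e']
        simp only [Pi.sub_apply, sub_mul]
      change ‖AsymptoticFunctions.pairing (F.1 φ).1 τ
        - AsymptoticFunctions.pairing (G.1 φ).1 τ‖ < _
      rw [e]
      refine ((norm_pairing_le τ fun x hx => ?_).trans_eq (mul_comm _ _)).trans_lt h2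
      simpa [partialDeriv_zero] using h1 x hx)

/-- Weak equality `f ≅ g`: the pairings with every test function coincide. -/
def AsymptoticFunction.WeaklyEqual (f g : AsymptoticFunction U Ω) : Prop :=
  ∀ τ : 𝓓(Ω, ℂ), AsymptoticFunction.pairing τ f = AsymptoticFunction.pairing τ g

/-- Association `f ≈ g`: the pairings with every test function differ by an infinitesimal. -/
def AsymptoticFunction.Associated (f g : AsymptoticFunction U Ω) : Prop :=
  ∀ τ : 𝓓(Ω, ℂ),
    (AsymptoticFunction.pairing τ f - AsymptoticFunction.pairing τ g).IsInfinitesimal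

end AsymptoticFunctions

/-! ### Distributions -/

section Distributions

variable {d : ℕ} {Ω : Opens (Vec d)}

/-- `𝓓'(Ω)`: the complex Schwartz distributions on `Ω`, the continuous `ℂ`-linear functionals on
`𝓓(Ω)`. The pairing `(T | τ)` is `T τ`. -/
abbrev ComplexDistribution (Ω : Opens (Vec d)) : Type := 𝓓(Ω, ℂ) →L[ℂ] ℂ

/-- The Schwartz embedding `L_Ω`: the regular distribution `τ ↦ ∫_Ω g τ` with locally integrable
kernel `g`. -/
def schwartzEmbedding (g : Ω → ℂ)
    (hg : LocallyIntegrableOn (extendZero g) (Ω : Set (Vec d))) : ComplexDistribution Ω :=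
  TestFunction.mkCLM ℂ (fun τ => pairing g τ)
    (fun σ τ => by
      have h := fun τ : 𝓓(Ω, ℂ) =>
        (τ.integrable_bilin (𝕜 := ℂ) (ContinuousLinearMap.mul ℂ ℂ).flip hg).integrableOn
          (s := (Ω : Set (Vec d)))
      simp only [ContinuousLinearMap.flip_apply, ContinuousLinearMap.mul_apply'] at h
      simp only [pairing, FunLike.coe_add, Pi.add_apply, mul_add]
      exact integral_add (h σ) (h τ))
    (fun c τ => by
      simp only [pairing, FunLike.coe_smul, Pi.smul_apply, smul_eq_mul, ← integral_const_mul]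
      congr 1
      funext x
      ring)
    (by
      intro K hK
      have h := (TestFunction.integralAgainstBilinCLM (Ω := Ω) (n := ⊤)
        (ContinuousLinearMap.mul ℂ ℂ).flip volume (extendZero g)).continuous.comp
        (TestFunction.continuous_ofSupportedIn (n := ⊤) (F := ℂ) hK)
      refine h.congr fun τ => ?_
      simp only [Function.comp_apply, TestFunction.integralAgainstBilinCLM_eq_integral hg,
        ContinuousLinearMap.flip_apply, ContinuousLinearMap.mul_apply', pairing]
      refine (setIntegral_eq_integral_of_forall_compl_eq_zero fun x hx => ?_).symm
      have hx' : x ∉ Ω := hx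
      simp [extendZero, hx'])

theorem continuousOn_extendZero (g : C(Ω, ℂ)) :
    ContinuousOn (extendZero g) (Ω : Set (Vec d)) := by
  rw [continuousOn_iff_continuous_domRestrict]
  refine g.continuous.congr fun x => ?_
  simp [extendZero_coe]

/-- The regular distribution with a continuous kernel. -/
def ofContinuous (g : C(Ω, ℂ)) : ComplexDistribution Ω :=
  schwartzEmbedding g
    ((continuousOn_extendZero g).locallyIntegrableOn Ω.isOpen.measurableSet)

/-- The regular distribution with a smooth kernel. -/
def ofSmooth (f : smoothFunctions Ω) : ComplexDistribution Ω :=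
  schwartzEmbedding f.1
    ((f.2 : ContDiffOn ℝ ∞ (extendZero f.1) Ω).continuousOn.locallyIntegrableOn
      Ω.isOpen.measurableSet)

/-- A smooth function on `Ω` agrees near a compact set with a smooth function on `ℝ^d`. -/
theorem exists_contDiff_eqOn (f : smoothFunctions Ω) {K : Set (Vec d)} (hK : IsCompact K)
    (hKΩ : K ⊆ Ω) : ∃ g : Vec d → ℂ, ContDiff ℝ ∞ g ∧ ∀ x ∈ K, g x = extendZero f.1 x := by
  obtain ⟨χ, h0, h1, -⟩ := exists_contMDiffMap_zero_one_nhds_of_isClosed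
    (modelWithCornersSelf ℝ (Vec d)) (n := ⊤) (s := (Ω : Set (Vec d))ᶜ) (t := K)
    Ω.isOpen.isClosed_compl hK.isClosed
    (Set.disjoint_left.2 fun x hx hxK => hx (hKΩ hxK))
  have hχ : ContDiff ℝ ∞ χ := χ.contMDiff.contDiff
  refine ⟨fun x => χ x • extendZero f.1 x, ?_, fun x hx => ?_⟩
  · rw [contDiff_iff_contDiffAt]
    intro x
    by_cases hx : x ∈ Ω
    · exact hχ.contDiffAt.smul (contDiffAt_extendZero f hx)
    · have h : (fun y => χ y • extendZero f.1 y) =ᶠ[𝓝 x] fun _ => (0 : ℂ) := by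
        filter_upwards [eventually_nhdsSet_iff_forall.1 h0 x hx] with y hy
        simp [hy]
      exact contDiffAt_const.congr_of_eventuallyEq h
  · have := (eventually_nhdsSet_iff_forall.1 h1 x hx).self_of_nhds
    simp [this]

/-- The test function `f τ` for a smooth function `f` on `Ω` and a test function `τ` on `Ω`. -/
def mulTest (f : smoothFunctions Ω) (τ : 𝓓(Ω, ℂ)) : 𝓓(Ω, ℂ) where
  toFun x := τ x * extendZero f.1 x
  contDiff' := by
    obtain ⟨g, hg, hgf⟩ := exists_contDiff_eqOn f τ.hasCompactSupport.isCompact τ.tsupport_subset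
    have e : (fun x => τ x * extendZero f.1 x) = fun x => τ x * g x := by
      funext x
      by_cases hx : x ∈ tsupport τ
      · rw [hgf x hx]
      · simp [image_eq_zero_of_notMem_tsupport hx]
    rw [e]
    exact τ.contDiff.mul hg
  hasCompactSupport' := τ.hasCompactSupport.mul_right
  tsupport_subset' := (tsupport_mul_subset_left).trans τ.tsupport_subset

/-- Multiplication of test functions by a smooth function, as a continuous linear map. -/
def mulTestCLM (f : smoothFunctions Ω) : 𝓓(Ω, ℂ) →L[ℂ] 𝓓(Ω, ℂ) :=
  TestFunction.mkCLM ℂ (mulTest f)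
    (fun σ τ => TestFunction.ext fun x => add_mul (σ x) (τ x) _)
    (fun c τ => TestFunction.ext fun x => mul_assoc c (τ x) _)
    (by
      intro K hK
      obtain ⟨g, hg, hgf⟩ := exists_contDiff_eqOn f K.isCompact hK
      have h := (TestFunction.continuous_ofSupportedIn (n := ⊤) (F := ℂ) hK).comp
        (ContDiffMapSupportedIn.bilinLeftCLM (K := K) (n := ⊤)
          (ContinuousLinearMap.mul ℂ ℂ) hg).continuous
      refine h.congr fun τ => TestFunction.ext fun x => ?_
      change τ x * g x = τ x * extendZero f.1 x
      by_cases hx : x ∈ (K : Set (Vec d))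
      · rw [hgf x hx]
      · have : τ x = 0 := τ.zero_on_compl hx
        simp [this])

/-- The product `f T` of a smooth function and a distribution: `(f T | τ) = (T | f τ)`. -/
def smoothMul (f : smoothFunctions Ω) (T : ComplexDistribution Ω) : ComplexDistribution Ω :=
  T.comp (mulTestCLM f)

theorem smoothMul_apply (f : smoothFunctions Ω) (T : ComplexDistribution Ω) (τ : 𝓓(Ω, ℂ)) :
    smoothMul f T τ = T (mulTest f τ) := rfl

end Distributions

/-! ### Regularization and the distributional embedding -/

section Embedding

variable {d : ℕ}

/-- The set of the `x ∈ Ω` with `d(x, ∂Ω) > 2 R_φ` and `‖x‖ < 1 / R_φ`; the distance to an empty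
boundary is infinite. -/
def cutoffSet (Ω : Opens (Vec d)) (φ : TestSpace d) : Set (Vec d) :=
  {x | x ∈ Ω ∧ ENNReal.ofReal (2 * suppRadius φ) < Metric.infEDist x (frontier (Ω : Set (Vec d))) ∧
    ‖x‖ < 1 / suppRadius φ}

/-- The cut-off net `C_{Ω,φ}`: the convolution of the characteristic function of `cutoffSet Ω φ`
with `φ`. -/
def cutoff (Ω : Opens (Vec d)) (φ : TestSpace d) (x : Vec d) : ℂ :=
  ∫ t in cutoffSet Ω φ, φ (x - t)

theorem measurableSet_cutoffSet (Ω : Opens (Vec d)) (φ : TestSpace d) :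
    MeasurableSet (cutoffSet Ω φ) := by
  refine (Ω.isOpen.inter (IsOpen.inter ?_ ?_)).measurableSet
  · exact isOpen_lt continuous_const Metric.continuous_infEDist
  · exact isOpen_lt continuous_norm continuous_const

theorem contDiff_cutoff (Ω : Opens (Vec d)) (φ : TestSpace d) : ContDiff ℝ ∞ (cutoff Ω φ) := by
  have hf : LocallyIntegrable ((cutoffSet Ω φ).indicator fun _ => (1 : ℂ)) :=
    (locallyIntegrable_const (1 : ℂ)).indicator (measurableSet_cutoffSet Ω φ)
  have h := φ.hasCompactSupport.contDiff_convolution_right (n := ⊤)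
    (ContinuousLinearMap.mul ℝ ℂ) hf φ.contDiff
  convert h using 1
  funext x
  rw [cutoff, ← integral_indicator (measurableSet_cutoffSet Ω φ)]
  refine integral_congr_ae (Filter.Eventually.of_forall fun t => ?_)
  by_cases ht : t ∈ cutoffSet Ω φ <;> simp [ht]

theorem exists_of_cutoff_ne_zero {Ω : Opens (Vec d)} {φ : TestSpace d} {x : Vec d}
    (hx : cutoff Ω φ x ≠ 0) : ∃ t ∈ cutoffSet Ω φ, dist x t ≤ suppRadius φ := by
  by_contra! h
  refine hx (setIntegral_eq_zero_of_forall_eq_zero fun t ht => ?_)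
  by_contra h0
  have := norm_le_suppRadius φ h0
  rw [← dist_eq_norm] at this
  exact (h t ht).not_ge this

theorem lt_dist_of_mem_cutoffSet {Ω : Opens (Vec d)} {φ : TestSpace d} {t z : Vec d}
    (ht : t ∈ cutoffSet Ω φ) (hz : z ∉ Ω) : 2 * suppRadius φ < dist t z := by
  obtain ⟨y, hy, hty⟩ := exists_mem_frontier_infDist_compl_eq_dist (s := (Ω : Set (Vec d)))
    ht.1 (fun h => hz (by have : z ∈ (Ω : Set (Vec d)) := h ▸ Set.mem_univ z; exact this))
  have h1 : dist t y ≤ dist t z := hty ▸ Metric.infDist_le_dist_of_mem hz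
  have h2 := ht.2.1.trans_le (Metric.infEDist_le_edist_of_mem hy)
  rw [edist_dist] at h2
  exact (ENNReal.ofReal_lt_ofReal_iff'.1 h2).1.trans_le h1

theorem tsupport_cutoff_subset [NeZero d] (Ω : Opens (Vec d)) (φ : TestSpace d) :
    tsupport (cutoff Ω φ) ⊆ {x | ∀ z ∉ Ω, suppRadius φ ≤ dist x z} ∩
      Metric.closedBall 0 (1 / suppRadius φ + suppRadius φ) := by
  refine closure_minimal ?_ (IsClosed.inter ?_ Metric.isClosed_closedBall)
  · intro x hx
    obtain ⟨t, ht, hxt⟩ := exists_of_cutoff_ne_zero hx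
    refine ⟨fun z hz => ?_, ?_⟩
    · have h1 := lt_dist_of_mem_cutoffSet ht hz
      have h2 := dist_triangle_left t z x
      linarith
    · have h1 := ht.2.2
      have h2 := dist_triangle x t 0
      rw [dist_zero_right t] at h2
      rw [Metric.mem_closedBall]
      linarith
  · simp only [Set.ofPred_forall]
    exact isClosed_iInter fun z => isClosed_iInter fun _ =>
      isClosed_le continuous_const (continuous_id.dist continuous_const)

/-- The test function `t ↦ C_{Ω,φ}(t) φ(x - t)` on `Ω`. -/
def kernelTest [NeZero d] (Ω : Opens (Vec d)) (φ : TestSpace d) (x : Vec d) : 𝓓(Ω, ℂ) where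
  toFun t := cutoff Ω φ t * φ (x - t)
  contDiff' := (contDiff_cutoff Ω φ).mul (φ.contDiff.comp (contDiff_const.sub contDiff_id))
  hasCompactSupport' := HasCompactSupport.mul_right
    (HasCompactSupport.of_support_subset_isCompact (isCompact_closedBall 0 _)
      ((subset_tsupport _).trans ((tsupport_cutoff_subset Ω φ).trans Set.inter_subset_right)))
  tsupport_subset' := by
    refine tsupport_mul_subset_left.trans ((tsupport_cutoff_subset Ω φ).trans fun x hx => ?_)
    by_contra h
    have := hx.1 x h
    rw [dist_self] at this
    exact this.not_gt (suppRadius_pos φ)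

/-- The `φ`-regularization `T ⊛ φ` of a distribution: `(T ⊛ φ)(x) = (T(t) | C_{Ω,φ}(t) φ(x - t))`
for `x ∈ Ω`. -/
def regularization [NeZero d] {Ω : Opens (Vec d)} (T : ComplexDistribution Ω) (φ : TestSpace d)
    (x : Ω) : ℂ :=
  T (kernelTest Ω φ x)

/-- The distributional embedding `E_Ω`: the class of the net `(T ⊛ φ)`. It takes as an argument the
fact that these nets are moderate. -/
def distributionalEmbedding [NeZero d] {U : DirectingUltrafilter d} {Ω : Opens (Vec d)}
    (h : ∀ T : ComplexDistribution Ω, IsModerate U Ω (regularization T))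
    (T : ComplexDistribution Ω) : AsymptoticFunction U Ω :=
  AsymptoticFunction.ofNet (regularization T) (h T)

end Embedding

end AsymptoticFunctions

open AsymptoticFunctions

/-!
The theorem rests on three estimates for the regularization `T ⊛ φ`, as the radius `R = R_φ` of the
support tends to `0` along the ultrafilter. On a compact subset of `Ω` the cut-off `C_{Ω,φ}` is
eventually `1` (`eventually_cutoff_eq_one`), so that there `T ⊛ φ` is the plain convolution.

*Moderateness* (`isModerate_regularization`). The function `x ↦ (T(t) | χ(t) θ(t - x))` is smooth,
with derivatives obtained by differentiating `θ`. To prove this for a distribution, which is not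
given by an integral, one uses that `T(χ ·)` has finite order: it is bounded by the suprema of
finitely many derivatives, hence by the Hahn–Banach theorem it is a continuous functional `Λ` on a
Banach space of jets (`exists_eq_comp_jet`), and in that space the translates of `θ` form a
differentiable curve (`hasFDerivAt_jet_translate`). The bounds on the derivatives of `φ` in the
directing sets then give negative powers of `R`.

*Weak approximation* (`eventually_norm_pairing_regularization_sub_lt`). The functional `Λ` commutes
with Bochner integrals, so `∫ (T ⊛ φ) τ = (T | φ * τ)` up to cut-off and reflection. By Taylor's
formula and the vanishing moments of `φ`, every derivative of `φ * τ` differs from that of `τ` by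
`O(R^p)` for every `p` (`exists_norm_integral_sub_le`), and so does `∫ (T ⊛ φ) τ` from `(T | τ)`.

*Approximation of functions*. For smooth `f` the same Taylor estimate shows that `f ⊛ φ - f` is
`O(R^p)` uniformly on compact sets; for continuous `g`, uniform continuity and `∫ |φ| ≤ 2` show that
`g ⊛ φ → g` uniformly on compact sets.

For (i), `∫ (f ⊛ φ) (T ⊛ φ) τ` may be replaced by `∫ (T ⊛ φ) (f τ)`, as `T ⊛ φ` is moderate and
`f ⊛ φ - f` is negligible; by weak approximation both this and `∫ (f T ⊛ φ) τ` agree with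
`(T | f τ)`. For (ii), `(g ⊛ φ) (k ⊛ φ)` and `(g k) ⊛ φ` both tend to `g k` uniformly on the support
of `τ`.
-/

namespace AsymptoticFunctions

/-! ### Calculus: translates and convolutions -/

section Translation

variable {E F : Type*} [NormedAddCommGroup E] [NormedAddCommGroup F]

/-- The translation `t ↦ g (t - x)` of a compactly supported continuous function, as a bounded
continuous function. -/
def translateBCF (g : E → F) (hg : Continuous g) (hs : HasCompactSupport g) (x : E) :
    BoundedContinuousFunction E F :=
  BoundedContinuousFunction.ofNormedAddCommGroup (fun t => g (t - x))
    (hg.comp (continuous_id.sub continuous_const)) (hg.bounded_above_of_compact_support hs).choose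
    fun t => (hg.bounded_above_of_compact_support hs).choose_spec (t - x)

@[simp] theorem translateBCF_apply (g : E → F) (hg : Continuous g) (hs : HasCompactSupport g)
    (x t : E) : translateBCF g hg hs x t = g (t - x) := rfl

theorem continuous_translateBCF {g : E → F} (hg : Continuous g) (hs : HasCompactSupport g) :
    Continuous (translateBCF g hg hs) := by
  rw [Metric.continuous_iff]
  intro x ε hε
  obtain ⟨δ, hδ, h⟩ := Metric.uniformContinuous_iff.1 (hs.uniformContinuous_of_continuous hg)
    (ε / 2) (by positivity)
  refine ⟨δ, hδ, fun y hy => ?_⟩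
  refine lt_of_le_of_lt ((BoundedContinuousFunction.dist_le (by positivity)).2 fun t => ?_)
    (half_lt_self hε)
  refine (h ?_).le
  rwa [dist_sub_left]

variable [MeasureSpace E] [OpensMeasurableSpace E]
  [IsFiniteMeasureOnCompacts (volume : Measure E)]

theorem integrable_smul_translate [NormedSpace ℂ F] {a : E → ℂ} {g : E → F} (ha : Continuous a)
    (hac : HasCompactSupport a) (hg : Continuous g) (t : E) :
    Integrable (fun y => a y • g (t - y)) :=
  (ha.smul (hg.comp (continuous_const.sub continuous_id))).integrable_of_hasCompactSupport
    hac.smul_right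

end Translation

section Analysis

variable {E F : Type*} [NormedAddCommGroup E] [NormedSpace ℝ E] [NormedAddCommGroup F]
  [NormedSpace ℝ F]

theorem hasCompactSupport_iteratedFDeriv {θ : E → F} (h : HasCompactSupport θ) (k : ℕ) :
    HasCompactSupport (iteratedFDeriv ℝ k θ) :=
  h.mono' (support_iteratedFDeriv_subset k)

/-- Schwarz's theorem for iterated derivatives: a directional derivative commutes with the
iterated derivative of any order. -/
theorem fderiv_iteratedFDeriv_apply {θ : E → F} (hθ : ContDiff ℝ ∞ θ) (k : ℕ) (y v : E) :
    fderiv ℝ (iteratedFDeriv ℝ k θ) y v = iteratedFDeriv ℝ k (fun z => fderiv ℝ θ z v) y := by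
  have hd : ∀ j, ContDiff ℝ ∞ (iteratedFDeriv ℝ j θ) := fun j =>
    hθ.iteratedFDeriv_right (mod_cast le_top)
  have hv : ∀ w, ContDiff ℝ ∞ (fun z => fderiv ℝ θ z w) := fun w =>
    (hθ.fderiv_right (m := ∞) (mod_cast le_top)).clm_apply contDiff_const
  induction k generalizing y v with
  | zero =>
    ext m
    have h0 : iteratedFDeriv ℝ 0 θ = (continuousMultilinearCurryFin0 ℝ E F).symm ∘ θ :=
      iteratedFDeriv_zero_eq_comp
    rw [iteratedFDeriv_zero_apply, h0, LinearIsometryEquiv.comp_fderiv]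
    rfl
  | succ k ih =>
    ext m
    have hdiff : ∀ j z, DifferentiableAt ℝ (iteratedFDeriv ℝ j θ) z := fun j z =>
      ((hd j).differentiable (by simp)) z
    rw [← fderiv_continuousMultilinear_apply_const_apply (hdiff _ _),
      iteratedFDeriv_succ_apply_left,
      ← fderiv_continuousMultilinear_apply_const_apply
        (((hv v).iteratedFDeriv_right (m := ∞) (mod_cast le_top)).differentiable (by simp) y)]
    set u : E → F := fun z => iteratedFDeriv ℝ k θ z (Fin.tail m) with hu
    have hu' : ContDiff ℝ ∞ u :=
      (ContinuousMultilinearMap.apply ℝ (fun _ : Fin k => E) F (Fin.tail m)).contDiff.comp (hd k)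
    have e1 : (fun z => iteratedFDeriv ℝ (k + 1) θ z m) = fun z => fderiv ℝ u z (m 0) := by
      funext z
      rw [iteratedFDeriv_succ_apply_left,
        ← fderiv_continuousMultilinear_apply_const_apply (hdiff _ _)]
    have e2 : (fun z => iteratedFDeriv ℝ k (fun z => fderiv ℝ θ z v) z (Fin.tail m))
        = fun z => fderiv ℝ u z v := by
      funext z
      rw [← ih z v, ← fderiv_continuousMultilinear_apply_const_apply (hdiff _ _)]
    have hu2 : DifferentiableAt ℝ (fderiv ℝ u) y :=
      ((hu'.fderiv_right (m := ∞) (mod_cast le_top)).differentiable (by simp)) y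
    have hs : ∀ a b : E, fderiv ℝ (fun z => fderiv ℝ u z a) y b = fderiv ℝ (fderiv ℝ u) y b a := by
      intro a b
      rw [fderiv_clm_apply hu2 (differentiableAt_const a)]
      simp
    rw [e1, e2, hs, hs]
    exact (hu'.contDiffAt.isSymmSndFDerivAt (by
      simpa using WithTop.coe_le_coe.2 (le_top : (2 : ℕ∞) ≤ ⊤))) v (m 0)

/-- The derivative of `x ↦ g (· - x)` in the direction `v`, for the supremum norm. -/
theorem hasFDerivAt_translateBCF {g : E → F} (hg : ContDiff ℝ 1 g) (hs : HasCompactSupport g)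
    (x : E) : ∃ A : E →L[ℝ] BoundedContinuousFunction E F,
      HasFDerivAt (translateBCF g hg.continuous hs) A x ∧
      ∀ v t, A v t = -fderiv ℝ g (t - x) v := by
  have hc : Continuous (fderiv ℝ g) := hg.continuous_fderiv one_ne_zero
  have hsc : HasCompactSupport (fderiv ℝ g) := hs.fderiv ℝ
  obtain ⟨M, hM⟩ := hc.bounded_above_of_compact_support hsc
  let A : E →L[ℝ] BoundedContinuousFunction E F := LinearMap.mkContinuous
    { toFun := fun v => BoundedContinuousFunction.ofNormedAddCommGroup
        (fun t => -fderiv ℝ g (t - x) v)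
        (((hc.comp (continuous_id.sub continuous_const)).clm_apply continuous_const).neg)
        (M * ‖v‖) (fun t => by
          rw [norm_neg]
          exact ((fderiv ℝ g (t - x)).le_opNorm v).trans
            (mul_le_mul_of_nonneg_right (hM _) (norm_nonneg _)))
      map_add' := fun v w => by ext t; simp; abel
      map_smul' := fun c v => by ext t; simp } M (fun v => by
        refine (BoundedContinuousFunction.norm_le (mul_nonneg ((norm_nonneg _).trans (hM 0))
          (norm_nonneg _))).2 fun t => ?_
        change ‖-fderiv ℝ g (t - x) v‖ ≤ _
        rw [norm_neg]
        exact ((fderiv ℝ g (t - x)).le_opNorm v).trans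
            (mul_le_mul_of_nonneg_right (hM _) (norm_nonneg _)))
  have hA : ∀ v t, A v t = -fderiv ℝ g (t - x) v := fun v t => rfl
  refine ⟨A, ?_, hA⟩
  rw [hasFDerivAt_iff_isLittleO, Asymptotics.isLittleO_iff]
  intro ε hε
  obtain ⟨δ, hδ, h⟩ := Metric.uniformContinuous_iff.1 (hsc.uniformContinuous_of_continuous hc)
    ε hε
  filter_upwards [Metric.ball_mem_nhds x hδ] with y hy
  refine (BoundedContinuousFunction.norm_le (by positivity)).2 fun t => ?_
  have hmv := (convex_ball (t - x) δ).norm_image_sub_le_of_norm_hasFDerivWithin_le' (f := g)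
    (f' := fderiv ℝ g) (φ := fderiv ℝ g (t - x)) (C := ε) (x := t - x) (y := t - y)
    (fun z _ => ((hg.differentiable one_ne_zero) z).hasFDerivAt.hasFDerivWithinAt)
    (fun z hz => by rw [← dist_eq_norm]; exact (h hz).le)
    (Metric.mem_ball_self hδ) (by rwa [Metric.mem_ball, dist_sub_left])
  have e : t - y - (t - x) = -(y - x) := by abel
  rw [e, norm_neg, map_neg] at hmv
  change ‖g (t - y) - g (t - x) - A (y - x) t‖ ≤ _
  rwa [hA]

end Analysis

section Convolution

variable {E : Type*} [NormedAddCommGroup E] [InnerProductSpace ℝ E] [FiniteDimensional ℝ E]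
  [MeasurableSpace E] [BorelSpace E]

theorem contDiff_integral_mul {a g : E → ℂ} (ha : Continuous a) (hg : ContDiff ℝ ∞ g)
    (hgc : HasCompactSupport g) : ContDiff ℝ ∞ (fun t => ∫ y, a y * g (t - y)) :=
  hgc.contDiff_convolution_right (n := ⊤) (ContinuousLinearMap.mul ℝ ℂ) ha.locallyIntegrable hg

theorem hasCompactSupport_integral_mul {a g : E → ℂ} (hac : HasCompactSupport a)
    (hgc : HasCompactSupport g) : HasCompactSupport (fun t => ∫ y, a y * g (t - y)) :=
  hac.convolution (ContinuousLinearMap.mul ℝ ℂ) hgc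

/-- Iterated derivatives of a convolution fall on the smooth factor. -/
theorem iteratedFDeriv_integral_mul_apply {a : E → ℂ} (ha : Continuous a)
    {g : E → ℂ} (hg : ContDiff ℝ ∞ g) (hgc : HasCompactSupport g)
    (k : ℕ) (t : E) (m : Fin k → E) :
    iteratedFDeriv ℝ k (fun t => ∫ y, a y * g (t - y)) t m =
      ∫ y, a y * iteratedFDeriv ℝ k g (t - y) m := by
  induction k generalizing g t with
  | zero => simp
  | succ k ih =>
    have hloc : LocallyIntegrable a := ha.locallyIntegrable
    have hconv := contDiff_integral_mul ha hg hgc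
    have hv : ∀ (f : E → ℂ) (_ : ContDiff ℝ ∞ f) (s v : E) (m : Fin k → E),
        iteratedFDeriv ℝ k (fun y => fderiv ℝ f y) s m v =
          iteratedFDeriv ℝ k (fun y => fderiv ℝ f y v) s m := fun f hf s v m =>
      (iteratedFDeriv_clm_apply_const_apply
        (hf.fderiv_right (m := ∞) (mod_cast le_top)) (mod_cast le_top)).symm
    rw [iteratedFDeriv_succ_apply_right, hv _ hconv]
    have hd : (fun z => fderiv ℝ (fun t => ∫ y, a y * g (t - y)) z (m (Fin.last k))) =
        fun z => ∫ y, a y * fderiv ℝ g (z - y) (m (Fin.last k)) := by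
      funext z
      have h := hgc.hasFDerivAt_convolution_right (ContinuousLinearMap.mul ℝ ℂ) hloc
        (hg.of_le (mod_cast le_top)) z
      have h' := h.fderiv
      rw [show (fun t => ∫ y, a y * g (t - y)) =
        MeasureTheory.convolution a g (ContinuousLinearMap.mul ℝ ℂ) volume from rfl, h',
        convolution_precompR_apply (ContinuousLinearMap.mul ℝ ℂ) hloc (hgc.fderiv ℝ)
          (hg.continuous_fderiv (by simp))]
      rfl
    have hg' : ContDiff ℝ ∞ (fun z => fderiv ℝ g z (m (Fin.last k))) :=
      (hg.fderiv_right (m := ∞) (mod_cast le_top)).clm_apply contDiff_const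
    have hgc' : HasCompactSupport (fun z => fderiv ℝ g z (m (Fin.last k))) :=
      (hgc.fderiv ℝ).mono' (Function.support_subset_iff'.2 fun x hx => by
        simp [image_eq_zero_of_notMem_tsupport hx])
    rw [hd, ih hg' hgc']
    refine integral_congr_ae (Eventually.of_forall fun y => ?_)
    change a y * _ = a y * _
    rw [iteratedFDeriv_succ_apply_right, hv _ hg]

theorem iteratedFDeriv_integral_mul {a : E → ℂ} (ha : Continuous a) (hac : HasCompactSupport a)
    {g : E → ℂ} (hg : ContDiff ℝ ∞ g) (hgc : HasCompactSupport g) (k : ℕ) (t : E) :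
    iteratedFDeriv ℝ k (fun t => ∫ y, a y * g (t - y)) t =
      ∫ y, a y • iteratedFDeriv ℝ k g (t - y) := by
  ext m
  rw [iteratedFDeriv_integral_mul_apply ha hg hgc]
  have hi := integrable_smul_translate ha hac
    (hg.continuous_iteratedFDeriv (m := k) (mod_cast le_top)) t
  exact ((ContinuousMultilinearMap.apply ℝ (fun _ : Fin k => E) ℂ m).integral_comp_comm hi)
end Convolution

/-! ### Distributions of finite order -/

/-- A linear functional that is bounded by the norm of a linear map into a normed space factors
through that map: the Hahn–Banach theorem on the range. -/
theorem exists_continuousLinearMap_comp_eq {V B : Type*} [AddCommGroup V] [Module ℂ V]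
    [NormedAddCommGroup B] [NormedSpace ℂ B] (J : V →ₗ[ℂ] B) (f : V →ₗ[ℂ] ℂ) (C : ℝ)
    (h : ∀ v, ‖f v‖ ≤ C * ‖J v‖) : ∃ Λ : B →L[ℂ] ℂ, ∀ v, Λ (J v) = f v := by
  have hker : LinearMap.ker J ≤ LinearMap.ker f := fun v hv => by
    have := h v
    rw [LinearMap.mem_ker.1 hv, norm_zero, mul_zero] at this
    exact norm_le_zero_iff.1 this
  let f' : LinearMap.range J →ₗ[ℂ] ℂ :=
    (LinearMap.ker J).liftQ f hker ∘ₗ J.quotKerEquivRange.symm.toLinearMap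
  have hf' : ∀ v, f' ⟨J v, v, rfl⟩ = f v := fun v => by
    have e : J.quotKerEquivRange.symm ⟨J v, v, rfl⟩ = (LinearMap.ker J).mkQ v :=
      J.quotKerEquivRange_symm_apply_image v _
    change (LinearMap.ker J).liftQ f hker (J.quotKerEquivRange.symm ⟨J v, v, rfl⟩) = f v
    rw [e]
    rfl
  obtain ⟨Λ, hΛ, -⟩ := exists_extension_norm_eq (LinearMap.range J)
    (f'.mkContinuous C (by rintro ⟨_, v, rfl⟩; rw [hf']; exact h v))
  exact ⟨Λ, fun v => (hΛ ⟨J v, v, rfl⟩).trans (hf' v)⟩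

section Distributions

variable {d : ℕ} {Ω : Opens (Vec d)}

/-- A distribution has finite order on every compact set. -/
theorem exists_norm_apply_le (T : ComplexDistribution Ω) {K : Set (Vec d)} (hK : IsCompact K)
    (hKΩ : K ⊆ Ω) : ∃ (N : ℕ) (C : ℝ), 0 ≤ C ∧ ∀ ψ : 𝓓(Ω, ℂ), (∀ x ∉ K, ψ x = 0) →
      ∀ M, 0 ≤ M → (∀ k ≤ N, ∀ x ∈ K, ‖iteratedFDeriv ℝ k ψ x‖ ≤ M) → ‖T ψ‖ ≤ C * M := by
  let L : Compacts (Vec d) := ⟨K, hK⟩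
  let S := T.comp (TestFunction.ofSupportedInCLM ℂ (n := ⊤) (F := ℂ) (K := L) hKΩ)
  obtain ⟨s, C, -, hC⟩ := Seminorm.bound_of_continuous
    (ContDiffMapSupportedIn.withSeminorms ℂ (Vec d) ℂ ⊤ L)
    ((normSeminorm ℂ ℂ).comp S.toLinearMap) (continuous_norm.comp S.continuous)
  refine ⟨s.sup id, C, C.2, fun ψ hψ M hM h => ?_⟩
  let ψ' : 𝓓^{(⊤ : ℕ∞)}_{L}(Vec d, ℂ) := ⟨ψ, ψ.contDiff, fun x hx => hψ x hx⟩
  have e : S ψ' = T ψ := congrArg T (TestFunction.ext fun x => rfl)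
  rw [← e]
  refine (hC ψ').trans ?_
  refine mul_le_mul_of_nonneg_left ?_ C.2
  refine Seminorm.finset_sup_apply_le hM fun i hi => ?_
  rw [ContDiffMapSupportedIn.seminorm_top_le_iff ℂ hM]
  exact fun x hx => h i (Finset.le_sup (f := id) hi) x hx

/-- The test function `χ ψ` on `Ω`, for a test function `χ` on `Ω` and a test function `ψ` on
`ℝ^d`. -/
def mulCutoff (χ : 𝓓(Ω, ℂ)) (ψ : TestSpace d) : 𝓓(Ω, ℂ) where
  toFun t := χ t * ψ t
  contDiff' := χ.contDiff.mul ψ.contDiff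
  hasCompactSupport' := χ.hasCompactSupport.mul_right
  tsupport_subset' := tsupport_mul_subset_left.trans χ.tsupport_subset

@[simp] theorem mulCutoff_apply (χ : 𝓓(Ω, ℂ)) (ψ : TestSpace d) (t : Vec d) :
    mulCutoff χ ψ t = χ t * ψ t := rfl

/-- The Banach space in which the derivatives of order at most `N` of a test function live: a finite
product of spaces of bounded continuous functions, with the supremum norm. -/
def JetSpace (d N : ℕ) : Type :=
  ∀ k : Fin (N + 1), BoundedContinuousFunction (Vec d)
    (ContinuousMultilinearMap ℝ (fun _ : Fin (k : ℕ) => Vec d) ℂ)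

instance (d N : ℕ) : NormedAddCommGroup (JetSpace d N) := Pi.normedAddCommGroup

instance (d N : ℕ) : NormedSpace ℂ (JetSpace d N) := Pi.normedSpace

instance (d N : ℕ) : NormedSpace ℝ (JetSpace d N) := Pi.normedSpace

instance (d N : ℕ) : IsScalarTower ℝ ℂ (JetSpace d N) :=
  ⟨fun r c f => funext fun k => BoundedContinuousFunction.ext fun t => smul_assoc r c (f k t)⟩

instance (d N : ℕ) : CompleteSpace (JetSpace d N) := Pi.complete _

/-- The derivatives of order at most `N` of a test function. -/
def jet (N : ℕ) : TestSpace d →ₗ[ℂ] JetSpace d N where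
  toFun ψ k := BoundedContinuousFunction.ofNormedAddCommGroup (iteratedFDeriv ℝ k ψ)
    (ψ.contDiff.continuous_iteratedFDeriv (m := k) (mod_cast le_top)) _
    ((ψ.contDiff.continuous_iteratedFDeriv (m := k)
      (mod_cast le_top)).bounded_above_of_compact_support
        (hasCompactSupport_iteratedFDeriv ψ.hasCompactSupport k)).choose_spec
  map_add' ψ η := by
    funext k
    ext1 t
    exact iteratedFDeriv_add_apply (ψ.contDiff.contDiffAt.of_le (mod_cast le_top))
      (η.contDiff.contDiffAt.of_le (mod_cast le_top))
  map_smul' c ψ := by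
    funext k
    ext1 t
    exact iteratedFDeriv_const_smul_apply (ψ.contDiff.contDiffAt.of_le (mod_cast le_top))

@[simp] theorem jet_apply (N : ℕ) (ψ : TestSpace d) (k : Fin (N + 1)) (t : Vec d) :
    jet N ψ k t = iteratedFDeriv ℝ k ψ t := rfl

/-- After multiplication by a fixed cut-off function, a distribution is a continuous functional of
finitely many derivatives of the test function. -/
theorem exists_eq_comp_jet (T : ComplexDistribution Ω) (χ : 𝓓(Ω, ℂ)) :
    ∃ (N : ℕ) (Λ : JetSpace d N →L[ℂ] ℂ), ∀ ψ : TestSpace d,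
      T (mulCutoff χ ψ) = Λ (jet N ψ) := by
  obtain ⟨N, C, hC, hT⟩ := exists_norm_apply_le T χ.hasCompactSupport.isCompact χ.tsupport_subset
  choose A hA using fun k : ℕ =>
    (χ.contDiff.continuous_iteratedFDeriv (m := k)
      (mod_cast le_top)).bounded_above_of_compact_support
        (hasCompactSupport_iteratedFDeriv χ.hasCompactSupport k)
  have hA0 : ∀ k, 0 ≤ A k := fun k => (norm_nonneg _).trans (hA k 0)
  let B := ∑ k ∈ Finset.range (N + 1), A k
  have hB0 : 0 ≤ B := Finset.sum_nonneg fun k _ => hA0 k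
  let f : TestSpace d →ₗ[ℂ] ℂ :=
    { toFun := fun ψ => T (mulCutoff χ ψ)
      map_add' := fun ψ η => by
        rw [← map_add]
        exact congrArg T (TestFunction.ext fun x => mul_add (χ x) (ψ x) (η x))
      map_smul' := fun c ψ => by
        rw [RingHom.id_apply, ← map_smul]
        exact congrArg T (TestFunction.ext fun x => mul_left_comm (χ x) c (ψ x)) }
  obtain ⟨Λ, hΛ⟩ := exists_continuousLinearMap_comp_eq (B := JetSpace d N) (jet N) f
    (C * (2 ^ N * B)) (fun ψ => by
    rw [mul_assoc]
    refine hT (mulCutoff χ ψ) (fun x hx => ?_) _ (by positivity) fun k hk x _ => ?_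
    · simp [image_eq_zero_of_notMem_tsupport hx]
    · refine (norm_iteratedFDeriv_mul_le (𝕜 := ℝ) (N := ∞) (f := χ) (g := ψ) χ.contDiff ψ.contDiff
        x (mod_cast le_top)).trans ?_
      refine (mul_bound (A := B) (B := ‖jet N ψ‖) (a := fun i => ‖iteratedFDeriv ℝ i χ x‖)
        (b := fun i => ‖iteratedFDeriv ℝ i ψ x‖) (fun _ _ => norm_nonneg _)
        (fun _ _ => norm_nonneg _) (fun i hi => (hA i x).trans ?_) (fun i hi => ?_)).trans ?_
      · exact Finset.single_le_sum (f := A) (fun k _ => hA0 k) (by simp; omega)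
      · exact ((jet N ψ ⟨i, by omega⟩).norm_coe_le_norm x).trans (norm_le_pi_norm (jet N ψ) _)
      · rw [mul_assoc]
        gcongr
        norm_num)
  exact ⟨N, Λ, fun ψ => (hΛ ψ).symm⟩

end Distributions

/-! ### Distributions applied to translates -/

section Translates

variable {d : ℕ} {Ω : Opens (Vec d)}

/-- The translate `t ↦ θ (t - x)` of a test function. -/
def translate (θ : TestSpace d) (x : Vec d) : TestSpace d where
  toFun t := θ (t - x)
  contDiff' := θ.contDiff.comp (contDiff_id.sub contDiff_const)
  hasCompactSupport' := θ.hasCompactSupport.comp_homeomorph (Homeomorph.subRight x)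
  tsupport_subset' := by simp

@[simp] theorem translate_apply (θ : TestSpace d) (x t : Vec d) : translate θ x t = θ (t - x) := rfl

/-- The test function `y ↦ D^k θ (y) (m₁, …, m_k)`. -/
def iterDeriv (θ : TestSpace d) (k : ℕ) (m : Fin k → Vec d) : TestSpace d where
  toFun y := iteratedFDeriv ℝ k θ y m
  contDiff' := (ContinuousMultilinearMap.apply ℝ (fun _ : Fin k => Vec d) ℂ m).contDiff.comp
    (θ.contDiff.iteratedFDeriv_right (m := ∞) (mod_cast le_top))
  hasCompactSupport' := (hasCompactSupport_iteratedFDeriv θ.hasCompactSupport k).comp_left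
    (g := fun A : ContinuousMultilinearMap ℝ (fun _ : Fin k => Vec d) ℂ => A m) rfl
  tsupport_subset' := by simp

@[simp] theorem iterDeriv_apply (θ : TestSpace d) (k : ℕ) (m : Fin k → Vec d) (y : Vec d) :
    iterDeriv θ k m y = iteratedFDeriv ℝ k θ y m := rfl

theorem jet_translate_apply (N : ℕ) (θ : TestSpace d) (x : Vec d) (k : Fin (N + 1)) :
    jet N (translate θ x) k = translateBCF (iteratedFDeriv ℝ k θ)
      (θ.contDiff.continuous_iteratedFDeriv (m := k) (mod_cast le_top))
      (hasCompactSupport_iteratedFDeriv θ.hasCompactSupport k) x := by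
  ext1 t
  exact iteratedFDeriv_comp_sub k x t

theorem continuous_jet_translate (N : ℕ) (θ : TestSpace d) :
    Continuous fun x => jet N (translate θ x) := by
  refine continuous_pi fun k => ?_
  simp only [jet_translate_apply]
  exact continuous_translateBCF _ _

theorem hasFDerivAt_jet_translate (N : ℕ) (θ : TestSpace d) (x : Vec d) :
    ∃ A : Vec d →L[ℝ] JetSpace d N, HasFDerivAt (fun x => jet N (translate θ x)) A x ∧
      ∀ v, A v = -jet N (translate (iterDeriv θ 1 fun _ => v) x) := by
  have hθ : ∀ k : ℕ, ContDiff ℝ 1 (iteratedFDeriv ℝ k θ) := fun k =>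
    θ.contDiff.iteratedFDeriv_right (mod_cast le_top)
  choose A hA hA' using fun k : Fin (N + 1) => hasFDerivAt_translateBCF (hθ k)
    (hasCompactSupport_iteratedFDeriv θ.hasCompactSupport k) x
  refine ⟨ContinuousLinearMap.pi A, ?_, fun v => ?_⟩
  · exact (hasFDerivAt_pi.2 hA).congr_of_eventuallyEq
      (Eventually.of_forall fun y => funext fun k => jet_translate_apply N θ y k)
  · funext k
    ext1 t
    change A k v t = -(jet N (translate (iterDeriv θ 1 fun _ => v) x) k t)
    rw [hA', jet_translate_apply, translateBCF_apply, fderiv_iteratedFDeriv_apply θ.contDiff]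
    congr 2
    funext z
    simp

/-- The function `x ↦ (T(t) | χ(t) θ(t - x))`, for a test function `χ` on `Ω`. -/
def cutoffConv (T : ComplexDistribution Ω) (χ : 𝓓(Ω, ℂ)) (θ : TestSpace d) (x : Vec d) : ℂ :=
  T (mulCutoff χ (translate θ x))

theorem hasFDerivAt_cutoffConv (T : ComplexDistribution Ω) (χ : 𝓓(Ω, ℂ)) (θ : TestSpace d)
    (x : Vec d) : ∃ A : Vec d →L[ℝ] ℂ, HasFDerivAt (cutoffConv T χ θ) A x ∧
      ∀ v, A v = -cutoffConv T χ (iterDeriv θ 1 fun _ => v) x := by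
  obtain ⟨N, Λ, hΛ⟩ := exists_eq_comp_jet T χ
  obtain ⟨A, hA, hA'⟩ := hasFDerivAt_jet_translate N θ x
  refine ⟨(Λ.restrictScalars ℝ).comp A, ?_, fun v => ?_⟩
  · have := (Λ.restrictScalars ℝ).hasFDerivAt.comp x hA
    refine this.congr_of_eventuallyEq (Eventually.of_forall fun y => ?_)
    exact hΛ _
  · change Λ (A v) = _
    rw [hA', map_neg, ← hΛ]
    rfl

theorem fderiv_cutoffConv_apply (T : ComplexDistribution Ω) (χ : 𝓓(Ω, ℂ)) (θ : TestSpace d)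
    (x v : Vec d) : fderiv ℝ (cutoffConv T χ θ) x v =
      -cutoffConv T χ (iterDeriv θ 1 fun _ => v) x := by
  obtain ⟨A, hA, hA'⟩ := hasFDerivAt_cutoffConv T χ θ x
  rw [hA.fderiv, hA']

theorem contDiff_cutoffConv (T : ComplexDistribution Ω) (χ : 𝓓(Ω, ℂ)) (θ : TestSpace d) :
    ContDiff ℝ ∞ (cutoffConv T χ θ) := by
  have hd : ∀ θ : TestSpace d, Differentiable ℝ (cutoffConv T χ θ) := fun θ x =>
    (hasFDerivAt_cutoffConv T χ θ x).choose_spec.1.differentiableAt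
  rw [contDiff_infty]
  intro n
  induction n generalizing θ with
  | zero => exact contDiff_zero.2 (hd θ).continuous
  | succ n ih =>
    refine contDiff_succ_iff_fderiv_apply.2
      ⟨hd θ, fun h => (WithTop.natCast_ne_top n h).elim, fun v => ?_⟩
    simp only [fderiv_cutoffConv_apply]
    exact (ih _).neg

theorem iteratedFDeriv_cutoffConv_apply (T : ComplexDistribution Ω) (χ : 𝓓(Ω, ℂ))
    (θ : TestSpace d) (k : ℕ) (x : Vec d) (m : Fin k → Vec d) :
    iteratedFDeriv ℝ k (cutoffConv T χ θ) x m =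
      (-1) ^ k * cutoffConv T χ (iterDeriv θ k m) x := by
  induction k generalizing x with
  | zero =>
    simp only [iteratedFDeriv_zero_apply, pow_zero, one_mul]
    exact congrArg (cutoffConv T χ · x) (TestFunction.ext fun y => by simp)
  | succ k ih =>
    have hd : ∀ (f : Vec d → ℂ), ContDiff ℝ ∞ f → Differentiable ℝ (iteratedFDeriv ℝ k f) :=
      fun f hf => (hf.iteratedFDeriv_right (m := 1) (mod_cast le_top)).differentiable one_ne_zero
    rw [iteratedFDeriv_succ_apply_left, ← fderiv_continuousMultilinear_apply_const_apply
      (hd _ (contDiff_cutoffConv T χ θ) x)]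
    simp only [ih]
    have hG := (contDiff_cutoffConv T χ (iterDeriv θ k (Fin.tail m))).differentiable
      (by simp) x
    have := (hG.hasFDerivAt.const_mul ((-1 : ℂ) ^ k)).fderiv
    rw [this, _root_.smul_apply, fderiv_cutoffConv_apply, pow_succ, smul_eq_mul, mul_assoc,
      neg_one_mul]
    congr 3
    refine TestFunction.ext fun y => ?_
    rw [iterDeriv_apply, iteratedFDeriv_one_apply, iterDeriv_apply,
      iteratedFDeriv_succ_apply_left]
    exact fderiv_continuousMultilinear_apply_const_apply (hd _ θ.contDiff y) _ _

/-- A distribution may be pulled out of an integral over translates of a test function: after the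
cut-off it is a continuous functional on the Banach space of jets, where the integral
converges. -/
theorem integral_mul_cutoffConv (T : ComplexDistribution Ω) (χ : 𝓓(Ω, ℂ)) {a : Vec d → ℂ}
    (ha : Continuous a) (hac : HasCompactSupport a) (θ σ : TestSpace d)
    (hσ : ∀ t, σ t = ∫ x, a x * θ (t - x)) :
    ∫ x, a x * cutoffConv T χ θ x = T (mulCutoff χ σ) := by
  obtain ⟨N, Λ, hΛ⟩ := exists_eq_comp_jet T χ
  have hi : Integrable (fun x => a x • jet N (translate θ x)) :=
    (ha.smul (continuous_jet_translate N θ)).integrable_of_hasCompactSupport hac.smul_right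
  have e : jet N σ = ∫ x, a x • jet N (translate θ x) := by
    funext k
    ext1 t
    have h := (((BoundedContinuousFunction.evalCLM ℂ t).comp
      (ContinuousLinearMap.proj (R := ℂ) (φ := fun k : Fin (N + 1) =>
        BoundedContinuousFunction (Vec d)
          (ContinuousMultilinearMap ℝ (fun _ : Fin (k : ℕ) => Vec d) ℂ)) k))).integral_comp_comm hi
    refine Eq.trans ?_ h
    rw [jet_apply, show (σ : Vec d → ℂ) = fun t => ∫ x, a x * θ (t - x) from funext hσ,
      iteratedFDeriv_integral_mul ha hac θ.contDiff θ.hasCompactSupport]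
    refine integral_congr_ae (Eventually.of_forall fun x => ?_)
    change a x • iteratedFDeriv ℝ k θ (t - x) = a x • jet N (translate θ x) k t
    rw [jet_translate_apply, translateBCF_apply]
  rw [hΛ, e, ← Λ.integral_comp_comm hi]
  refine integral_congr_ae (Eventually.of_forall fun x => ?_)
  change a x * T (mulCutoff χ (translate θ x)) = Λ (a x • jet N (translate θ x))
  rw [map_smul, hΛ, smul_eq_mul]

end Translates

/-! ### Consequences of the defining conditions of the directing sets -/

section DirectingSets

variable {d : ℕ}

theorem norm_iteratedFDeriv_iteratedFDeriv {E F : Type*} [NormedAddCommGroup E] [NormedSpace ℝ E]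
    [NormedAddCommGroup F] [NormedSpace ℝ F] (f : E → F) (j k : ℕ) (x : E) :
    ‖iteratedFDeriv ℝ j (iteratedFDeriv ℝ k f) x‖ = ‖iteratedFDeriv ℝ (j + k) f x‖ := by
  induction j generalizing k with
  | zero => rw [norm_iteratedFDeriv_zero, zero_add]
  | succ j ih =>
    rw [← norm_iteratedFDeriv_fderiv, fderiv_iteratedFDeriv,
      LinearIsometryEquiv.norm_iteratedFDeriv_comp_left, ih, Nat.add_right_comm, Nat.add_assoc]

/-- Derivatives of a directional derivative along vectors of norm at most `1` are bounded by
derivatives of higher order. -/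
theorem norm_iteratedFDeriv_iterDeriv_le (θ : TestSpace d) (j k : ℕ) {m : Fin k → Vec d}
    (hm : ∀ i, ‖m i‖ ≤ 1) (y : Vec d) :
    ‖iteratedFDeriv ℝ j (iterDeriv θ k m) y‖ ≤ ‖iteratedFDeriv ℝ (j + k) θ y‖ := by
  have hL : ‖ContinuousMultilinearMap.apply ℝ (fun _ : Fin k => Vec d) ℂ m‖ ≤ 1 :=
    ContinuousLinearMap.opNorm_le_bound _ zero_le_one fun A => by
      rw [mul_comm]
      exact (A.le_opNorm m).trans (mul_le_mul_of_nonneg_left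
        (Finset.prod_le_one (fun _ _ => norm_nonneg _) fun i _ => hm i) (norm_nonneg _))
  have h := (ContinuousMultilinearMap.apply ℝ (fun _ : Fin k => Vec d) ℂ
    m).norm_iteratedFDeriv_comp_left (f := iteratedFDeriv ℝ k θ) (x := y) (N := ∞) (n := j)
    (θ.contDiff.iteratedFDeriv_right (m := ∞) (mod_cast le_top)).contDiffAt (mod_cast le_top)
  rw [norm_iteratedFDeriv_iteratedFDeriv] at h
  exact h.trans (mul_le_of_le_one_left (norm_nonneg _) hL)

theorem eventually_suppRadius_lt [NeZero d] (U : DirectingUltrafilter d) {ε : ℝ} (hε : 0 < ε) :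
    ∀ᶠ φ in U.ae, suppRadius φ < ε := by
  filter_upwards [eventually_const_mul_le U ε⁻¹] with φ h
  have := h.resolve_right (not_le.2 (suppRadius_pos φ))
  rwa [inv_mul_lt_iff₀ hε, mul_one] at this

theorem integral_norm_le_two {n : ℕ} {φ : TestSpace d} (hφ : φ ∈ directingSet d (n + 1)) :
    ∫ y, ‖φ y‖ ≤ 2 := by
  refine hφ.2.2.2.2.2.1.trans ?_
  have : (1 : ℝ) / ((n + 1 : ℕ) : ℝ) ≤ 1 := by
    rw [div_le_one (by positivity)]
    push_cast
    linarith [n.cast_nonneg (α := ℝ)]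
  linarith

/-- The vanishing moments, for monomials written as products of coordinates. -/
theorem integral_prod_coord_mul_eq_zero {n k : ℕ} {φ : TestSpace d}
    (hφ : φ ∈ directingSet d (n + 1)) (h1 : 1 ≤ k) (hk : k ≤ n + 1) (β : Fin k → Fin d) :
    ∫ y : Vec d, ((∏ j, y (β j) : ℝ) : ℂ) * φ y = 0 := by
  let α : Fin d → ℕ := fun i => (Finset.univ.filter fun j => β j = i).card
  have hα : multiOrder α = k := by
    have := Finset.card_eq_sum_card_fiberwise (s := (Finset.univ : Finset (Fin k))) (f := β)
      (t := Finset.univ) (fun _ _ => Finset.mem_coe.2 (Finset.mem_univ _))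
    rw [Finset.card_univ, Fintype.card_fin] at this
    exact this.symm
  have hmon : ∀ y : Vec d, monomial α y = ∏ j, y (β j) := fun y => by
    have := Finset.prod_fiberwise' (Finset.univ : Finset (Fin k)) β (fun i => y i)
    simpa [monomial, α] using this
  have := hφ.2.2.2.2.1 α (by omega) (by omega)
  simpa only [hmon] using this

/-- The value of a multilinear map on the diagonal, in coordinates. -/
theorem multilinear_diag_eq_sum {k : ℕ}
    (A : ContinuousMultilinearMap ℝ (fun _ : Fin k => Vec d) ℂ) (y : Vec d) :
    A (fun _ => y) = ∑ β : Fin k → Fin d, ((∏ j, y (β j) : ℝ) : ℂ) *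
      A fun j => EuclideanSpace.single (β j) (1 : ℝ) := by
  have hy : (fun _ : Fin k => y) = fun _ => ∑ i, y i • EuclideanSpace.single i (1 : ℝ) := by
    funext j
    ext i
    simp [Pi.single_apply]
  have hs : A (fun _ => y) = ∑ β : Fin k → Fin d,
      A fun j => y (β j) • EuclideanSpace.single (β j) (1 : ℝ) := by
    conv_lhs => rw [hy]
    exact ContinuousMultilinearMap.map_sum _ _
  rw [hs]
  refine Finset.sum_congr rfl fun β _ => ?_
  rw [ContinuousMultilinearMap.map_smul_univ, Complex.real_smul]

theorem integrable_mul_testFunction (φ : TestSpace d) {f : Vec d → ℂ} (hf : Continuous f) :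
    Integrable fun y => f y * φ y :=
  (hf.mul φ.continuous).integrable_of_hasCompactSupport φ.hasCompactSupport.mul_left

/-- The terms of order `k ≥ 1` of a Taylor expansion are annihilated by the vanishing moments. -/
theorem integral_mul_multilinear_diag_eq_zero {n k : ℕ} {φ : TestSpace d}
    (hφ : φ ∈ directingSet d (n + 1)) (h1 : 1 ≤ k) (hk : k ≤ n + 1)
    (A : ContinuousMultilinearMap ℝ (fun _ : Fin k => Vec d) ℂ) :
    ∫ y : Vec d, A (fun _ => -y) * φ y = 0 := by
  have e : ∀ y : Vec d, A (fun _ => -y) * φ y = ∑ β : Fin k → Fin d,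
      ((-1) ^ k * A fun j => EuclideanSpace.single (β j) (1 : ℝ)) *
        (((∏ j, y (β j) : ℝ) : ℂ) * φ y) := fun y => by
    have hn : (fun _ : Fin k => -y) = fun _ => (-1 : ℝ) • y := by simp
    rw [hn, ContinuousMultilinearMap.map_smul_univ A (fun _ => (-1 : ℝ)) (fun _ => y),
      multilinear_diag_eq_sum, Complex.real_smul, Finset.mul_sum, Finset.sum_mul]
    refine Finset.sum_congr rfl fun β _ => ?_
    simp
    ring
  simp only [e]
  rw [integral_finsetSum]
  · refine Finset.sum_eq_zero fun β _ => ?_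
    rw [integral_const_mul, integral_prod_coord_mul_eq_zero hφ h1 hk, mul_zero]
  · intro β _
    refine (integrable_mul_testFunction φ ?_).const_mul _
    fun_prop

/-- Convolution with a member of the directing set of index `n + 1` reproduces a smooth function
up to order `n + 1` in the radius of support, uniformly on compact sets. -/
theorem exists_norm_integral_sub_le {f : Vec d → ℂ} (hf : ContDiff ℝ ∞ f) {K : Set (Vec d)}
    (hK : IsCompact K) (n : ℕ) : ∃ M, 0 ≤ M ∧ ∀ φ ∈ directingSet d (n + 1), ∀ x ∈ K,
      ‖(∫ y, φ y * f (x - y)) - f x‖ ≤ M * suppRadius φ ^ (n + 1) := by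
  have hfn : Continuous (iteratedFDeriv ℝ (n + 1) f) :=
    hf.continuous_iteratedFDeriv (mod_cast le_top)
  obtain ⟨B, hB⟩ := (hK.cthickening (r := 1)).exists_bound_of_continuousOn hfn.continuousOn
  refine ⟨2 * |B|, by positivity, fun φ hφ x hx => ?_⟩
  have hR1 : suppRadius φ ≤ 1 := hφ.2.2.1.trans (by
    rw [div_le_one (by positivity)]
    push_cast
    linarith [n.cast_nonneg (α := ℝ)])
  let P : Vec d → ℂ := fun y => ∑ k ∈ Finset.range (n + 1),
    (k.factorial : ℝ)⁻¹ • iteratedFDeriv ℝ k f x (fun _ => -y)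
  have hterm : ∀ k, Continuous fun y : Vec d => iteratedFDeriv ℝ k f x (fun _ => -y) := fun k =>
    (iteratedFDeriv ℝ k f x).cont.comp (by fun_prop)
  have hP : Continuous P := continuous_finsetSum _ fun k _ => (by
    have := hterm k
    fun_prop)
  have hPint : ∫ y, P y * φ y = f x := by
    have e : ∀ y, P y * φ y = ∑ k ∈ Finset.range (n + 1),
        (k.factorial : ℝ)⁻¹ • (iteratedFDeriv ℝ k f x (fun _ => -y) * φ y) := fun y => by
      simp only [P, Finset.sum_mul, smul_mul_assoc]
    simp only [e]
    have hint : ∀ k ∈ Finset.range (n + 1), Integrable fun y : Vec d =>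
        (k.factorial : ℝ)⁻¹ • (iteratedFDeriv ℝ k f x (fun _ => -y) * φ y) := fun k _ =>
      (integrable_mul_testFunction φ (hterm k)).smul ((k.factorial : ℝ)⁻¹)
    rw [integral_finsetSum _ hint,
      Finset.sum_eq_single 0]
    · rw [integral_smul]
      simp [integral_const_mul, hφ.2.2.2.1]
    · intro k hk hk0
      rw [integral_smul, integral_mul_multilinear_diag_eq_zero hφ (by omega)
        (by have := Finset.mem_range.1 hk; omega), smul_zero]
    · simp
  have hfc : Continuous fun y => f (x - y) := hf.continuous.comp (continuous_const.sub continuous_id)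
  have hsub : (∫ y, φ y * f (x - y)) - f x = ∫ y, (f (x - y) - P y) * φ y := by
    rw [← hPint, ← integral_sub _ (integrable_mul_testFunction φ hP)]
    · refine integral_congr_ae (Eventually.of_forall fun y => ?_)
      change φ y * f (x - y) - P y * φ y = (f (x - y) - P y) * φ y
      ring
    · simpa only [mul_comm] using integrable_mul_testFunction φ hfc
  -- the remainder, from the integral form of Taylor's formula on the segment from `x` to `x - y`
  have hrem : ∀ y, ‖y‖ ≤ suppRadius φ → ‖f (x - y) - P y‖ ≤ |B| * suppRadius φ ^ (n + 1) := by
    intro y hy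
    have ht := map_add_eq_sum_add_integral_iteratedFDeriv (f := f) (x := x) (y := -y) (n := n)
      fun t _ => hf.contDiffAt.of_le (mod_cast le_top)
    rw [← sub_eq_add_neg] at ht
    rw [ht, add_sub_cancel_left, norm_smul]
    have h1 : ‖((n.factorial : ℝ))⁻¹‖ ≤ 1 := by
      rw [norm_inv, Real.norm_natCast]
      exact inv_le_one_of_one_le₀ (mod_cast n.factorial_pos)
    refine (mul_le_of_le_one_left (norm_nonneg _) h1).trans ?_
    have h2 := intervalIntegral.norm_integral_le_of_norm_le_const (a := (0 : ℝ)) (b := 1)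
      (f := fun t : ℝ => (1 - t) ^ n • iteratedFDeriv ℝ (n + 1) f (x + t • -y) fun _ => -y)
      (C := |B| * suppRadius φ ^ (n + 1)) fun t ht => by
        rw [Set.uIoc_of_le zero_le_one] at ht
        have hz : x + t • -y ∈ Metric.cthickening 1 K := by
          refine Metric.mem_cthickening_of_dist_le _ x _ _ hx ?_
          rw [dist_eq_norm, add_sub_cancel_left, norm_smul, norm_neg, Real.norm_of_nonneg ht.1.le]
          exact mul_le_one₀ ht.2 (norm_nonneg _) (hy.trans hR1)
        rw [norm_smul, norm_pow, Real.norm_of_nonneg (by linarith [ht.2])]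
        refine (mul_le_of_le_one_left (norm_nonneg _)
          (pow_le_one₀ (by linarith [ht.2]) (by linarith [ht.1]))).trans ?_
        refine (ContinuousMultilinearMap.le_opNorm _ _).trans ?_
        rw [Finset.prod_const, Finset.card_univ, Fintype.card_fin, norm_neg]
        gcongr
        exact (hB _ hz).trans (le_abs_self B)
    simpa using h2
  rw [hsub]
  -- `φ` does not vanish identically, since `∫ φ = 1`
  have hR0 : 0 ≤ |B| * suppRadius φ ^ (n + 1) := by
    by_cases h0 : ∃ y, φ y ≠ 0
    · obtain ⟨y, hy⟩ := h0
      exact (norm_nonneg _).trans (hrem y (norm_le_suppRadius φ hy))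
    · push Not at h0
      have := hφ.2.2.2.1
      simp [h0] at this
  have hφi : Integrable (φ : Vec d → ℂ) :=
    φ.continuous.integrable_of_hasCompactSupport φ.hasCompactSupport
  calc ‖∫ y, (f (x - y) - P y) * φ y‖
      ≤ ∫ y, |B| * suppRadius φ ^ (n + 1) * ‖φ y‖ := by
        refine norm_integral_le_of_norm_le (hφi.norm.const_mul _)
          (Eventually.of_forall fun y => ?_)
        rw [norm_mul]
        by_cases hy : φ y = 0
        · simp [hy]
        · exact mul_le_mul_of_nonneg_right (hrem y (norm_le_suppRadius φ hy)) (norm_nonneg _)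
    _ = |B| * suppRadius φ ^ (n + 1) * ∫ y, ‖φ y‖ := integral_const_mul _ _
    _ ≤ |B| * suppRadius φ ^ (n + 1) * 2 :=
        mul_le_mul_of_nonneg_left (integral_norm_le_two hφ) hR0
    _ = _ := by ring

end DirectingSets

/-! ### Regularizations and moderateness -/

section Reflection

variable {d : ℕ}

/-- The test function `y ↦ φ (-y)`. -/
def reflect (φ : TestSpace d) : TestSpace d where
  toFun y := φ (-y)
  contDiff' := φ.contDiff.comp contDiff_neg
  hasCompactSupport' := φ.hasCompactSupport.comp_homeomorph (Homeomorph.neg _)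
  tsupport_subset' := by simp

@[simp] theorem reflect_apply (φ : TestSpace d) (y : Vec d) : reflect φ y = φ (-y) := rfl

theorem reflect_eq_self {n : ℕ} {φ : TestSpace d} (hφ : φ ∈ directingSet d (n + 1)) :
    reflect φ = φ := TestFunction.ext hφ.2.1

theorem translate_eq_zero_of_notMem_cthickening {K : Set (Vec d)} {δ : ℝ} {φ θ : TestSpace d}
    (hθ : ∀ y, θ y ≠ 0 → ‖y‖ ≤ suppRadius φ) (hδ : suppRadius φ ≤ δ) {x : Vec d} (hx : x ∈ K)
    {t : Vec d} (ht : t ∉ Metric.cthickening δ K) : translate θ x t = 0 := by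
  by_contra h
  refine ht (Metric.mem_cthickening_of_dist_le t x _ _ hx ?_)
  rw [dist_eq_norm]
  exact (hθ _ h).trans hδ

theorem norm_le_suppRadius_of_iterDeriv_ne_zero (φ : TestSpace d) {k : ℕ} {m : Fin k → Vec d}
    {y : Vec d} (hy : iterDeriv φ k m y ≠ 0) : ‖y‖ ≤ suppRadius φ := by
  have h1 : y ∈ tsupport φ := support_iteratedFDeriv_subset (𝕜 := ℝ) k fun h => hy (by simp [h])
  have h2 : tsupport φ ⊆ Metric.closedBall 0 (suppRadius φ) :=
    closure_minimal (fun z hz => by simpa using norm_le_suppRadius φ hz) Metric.isClosed_closedBall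
  simpa using h2 h1

end Reflection

section Regularization

variable {d : ℕ} [NeZero d] {Ω : Opens (Vec d)}

/-- The cut-off `C_{Ω,φ}` as a test function on `Ω`. -/
def cutoffTest (Ω : Opens (Vec d)) (φ : TestSpace d) : 𝓓(Ω, ℂ) where
  toFun := cutoff Ω φ
  contDiff' := contDiff_cutoff Ω φ
  hasCompactSupport' := HasCompactSupport.of_support_subset_isCompact (isCompact_closedBall 0 _)
    ((subset_tsupport _).trans ((tsupport_cutoff_subset Ω φ).trans Set.inter_subset_right))
  tsupport_subset' := (tsupport_cutoff_subset Ω φ).trans fun x hx => by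
    by_contra h
    have := hx.1 x h
    rw [dist_self] at this
    exact this.not_gt (suppRadius_pos φ)

@[simp] theorem cutoffTest_apply (φ : TestSpace d) (t : Vec d) :
    cutoffTest Ω φ t = cutoff Ω φ t := rfl

theorem kernelTest_eq_mulCutoff (φ : TestSpace d) (x : Vec d) :
    kernelTest Ω φ x = mulCutoff (cutoffTest Ω φ) (translate (reflect φ) x) :=
  TestFunction.ext fun t => by
    change cutoff Ω φ t * φ (x - t) = cutoff Ω φ t * φ (-(t - x))
    rw [neg_sub]

theorem extendZero_regularization_eventuallyEq (T : ComplexDistribution Ω) (φ : TestSpace d)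
    {x : Vec d} (hx : x ∈ Ω) : extendZero (regularization T φ) =ᶠ[𝓝 x]
      cutoffConv T (cutoffTest Ω φ) (reflect φ) := by
  filter_upwards [Ω.isOpen.mem_nhds hx] with y hy
  rw [extendZero_of_mem _ hy, cutoffConv, ← kernelTest_eq_mulCutoff]
  rfl

theorem regularization_mem_smoothFunctions (T : ComplexDistribution Ω) (φ : TestSpace d) :
    regularization T φ ∈ smoothFunctions Ω := by
  change ContDiffOn ℝ ∞ (extendZero (regularization T φ)) Ω
  exact (contDiff_cutoffConv T _ _).contDiffOn.congr fun x hx =>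
    (extendZero_regularization_eventuallyEq T φ hx).self_of_nhds

/-- On a compact subset of `Ω` the cut-off is eventually constantly equal to `1`. -/
theorem eventually_cutoff_eq_one (U : DirectingUltrafilter d) {K : Set (Vec d)} (hK : IsCompact K)
    (hKΩ : K ⊆ Ω) : ∀ᶠ φ in U.ae, ∀ t ∈ K, cutoff Ω φ t = 1 := by
  obtain ⟨δ, hδ, hδΩ⟩ := hK.exists_cthickening_subset_open Ω.isOpen hKΩ
  obtain ⟨r, hr⟩ := hK.isBounded.exists_norm_le
  filter_upwards [eventually_suppRadius_lt U (ε := δ / 4) (by positivity),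
    eventually_const_mul_le U (|r| + 1), eventually_le_one U, U.eventually_mem 1]
    with φ h1 h2 h3 h4 t ht
  have hR := suppRadius_pos φ
  replace h2 := h2.resolve_right (not_le.2 hR)
  have hmem : ∀ s, φ (t - s) ≠ 0 → s ∈ cutoffSet Ω φ := by
    intro s hs
    have hts : dist t s ≤ suppRadius φ := by
      rw [dist_eq_norm]
      exact norm_le_suppRadius φ hs
    refine ⟨hδΩ (Metric.mem_cthickening_of_dist_le s t _ _ ht
      (by rw [dist_comm]; linarith)), ?_, ?_⟩
    · refine ((ENNReal.ofReal_lt_ofReal_iff (by positivity)).2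
        (by linarith : 2 * suppRadius φ < 3 * suppRadius φ)).trans_le
        (Metric.le_infEDist.2 fun z hz => ?_)
      have hzΩ : z ∉ Ω := fun h => (Ω.isOpen.frontier_eq ▸ hz).2 h
      have hzt : δ < dist z t := by
        by_contra! h
        exact hzΩ (hδΩ (Metric.mem_cthickening_of_dist_le z t _ _ ht h))
      rw [edist_dist]
      refine ENNReal.ofReal_le_ofReal ?_
      have := dist_triangle z s t
      rw [dist_comm z s, dist_comm s t] at this
      linarith
    · rw [lt_div_iff₀ hR]
      have hs' : ‖s‖ ≤ |r| + 1 := by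
        have e1 := hr t ht
        have e2 : ‖s‖ ≤ ‖t‖ + ‖t - s‖ := by
          simpa using norm_sub_le t (t - s)
        rw [← dist_eq_norm] at e2
        linarith [le_abs_self r]
      exact (mul_le_mul_of_nonneg_right hs' hR.le).trans_lt h2
  rw [cutoff, setIntegral_eq_integral_of_forall_compl_eq_zero fun s hs => by
    by_contra h
    exact hs (hmem s h)]
  rw [integral_sub_left_eq_self (fun y => φ y)]
  exact h4.2.2.2.1

/-- The cut-off does not change a test function that is supported where the cut-off is `1`. -/
theorem mulCutoff_apply_of_support {K : Set (Vec d)} {φ σ : TestSpace d}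
    (hφ : ∀ t ∈ K, cutoff Ω φ t = 1) (hσ : ∀ t ∉ K, σ t = 0) (t : Vec d) :
    mulCutoff (cutoffTest Ω φ) σ t = σ t := by
  by_cases ht : t ∈ K
  · simp [hφ t ht]
  · simp [hσ t ht]

/-- The regularizations of a distribution form a moderate net: on a compact set only finitely many
derivatives of `φ` enter, and these are bounded by powers of the radius of support. -/
theorem isModerate_regularization (U : DirectingUltrafilter d) (T : ComplexDistribution Ω) :
    IsModerate U Ω (regularization T) := by
  refine ⟨regularization_mem_smoothFunctions T, fun K hK hKΩ k β => ?_⟩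
  obtain ⟨δ, hδ, hδΩ⟩ := hK.exists_cthickening_subset_open Ω.isOpen hKΩ
  have hK' : IsCompact (Metric.cthickening δ K) := hK.cthickening
  obtain ⟨N, C, hC, hT⟩ := exists_norm_apply_le T hK' hδΩ
  let c : ℝ := ∑ j ∈ Finset.range (N + 1), (Fintype.card (Fin (j + k) → Fin d) : ℝ)
  let q : ℕ := 2 * (N + k + d)
  refine ⟨q + 1, ?_⟩
  filter_upwards [eventually_suppRadius_lt U hδ, eventually_cutoff_eq_one U hK' hδΩ,
    U.eventually_mem (N + k + 1), eventually_le_one U,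
    eventually_const_mul_inv_pow_le U (C * c) q] with φ h1 h2 h3 h4 h5 x hx
  have hR := suppRadius_pos φ
  set m : Fin k → Vec d := fun j => EuclideanSpace.single (β j) (1 : ℝ)
  rw [partialDeriv, ((extendZero_regularization_eventuallyEq T φ (hKΩ hx)).iteratedFDeriv ℝ
    k).self_of_nhds, iteratedFDeriv_cutoffConv_apply, reflect_eq_self h3, norm_mul, norm_pow,
    norm_neg, norm_one, one_pow, one_mul, cutoffConv]
  refine le_trans ?_ h5
  rw [mul_assoc]
  have hsupp : ∀ t ∉ Metric.cthickening δ K, translate (iterDeriv φ k m) x t = 0 := fun t ht =>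
    translate_eq_zero_of_notMem_cthickening
      (fun y hy => norm_le_suppRadius_of_iterDeriv_ne_zero φ hy) h1.le hx ht
  have hfun : (mulCutoff (cutoffTest Ω φ) (translate (iterDeriv φ k m) x) : Vec d → ℂ) =
      fun t => iterDeriv φ k m (t - x) := funext fun t =>
    mulCutoff_apply_of_support h2 hsupp t
  refine hT _ (fun t ht => (mulCutoff_apply_of_support h2 hsupp t).trans (hsupp t ht)) _
    (by positivity) fun j hj t _ => ?_
  rw [hfun, iteratedFDeriv_comp_sub]
  refine (norm_iteratedFDeriv_iterDeriv_le φ j k (fun i => by simp [m]) _).trans ?_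
  refine (norm_iteratedFDeriv_le_sum _ _ _).trans ?_
  calc ∑ γ : Fin (j + k) → Fin d, ‖partialDeriv γ φ (t - x)‖
      ≤ ∑ _γ : Fin (j + k) → Fin d, (suppRadius φ ^ q)⁻¹ := Finset.sum_le_sum fun γ _ =>
        (h3.2.2.2.2.2.2 (j + k) (by omega) γ _).trans (inv_pow_le_inv_pow h4 (by simp [q]; omega))
    _ = (Fintype.card (Fin (j + k) → Fin d) : ℝ) * (suppRadius φ ^ q)⁻¹ := by
        rw [Finset.sum_const, nsmul_eq_mul]; rfl
    _ ≤ c * (suppRadius φ ^ q)⁻¹ := by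
        gcongr
        exact Finset.single_le_sum (f := fun j => (Fintype.card (Fin (j + k) → Fin d) : ℝ))
          (fun _ _ => Nat.cast_nonneg _) (by simp; omega)

end Regularization

/-! ### Weak approximation of distributions, uniform approximation of functions -/

section Smearing

variable {d : ℕ} {Ω : Opens (Vec d)}

/-- The convolution of a test function `τ` with the reflection of `φ`: the transpose of
regularization applied to `τ`. -/
def smear (φ : TestSpace d) (τ : 𝓓(Ω, ℂ)) : TestSpace d where
  toFun t := ∫ x, τ x * reflect φ (t - x)
  contDiff' := contDiff_integral_mul τ.continuous (reflect φ).contDiff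
    (reflect φ).hasCompactSupport
  hasCompactSupport' := hasCompactSupport_integral_mul τ.hasCompactSupport
    (reflect φ).hasCompactSupport
  tsupport_subset' := by simp

theorem smear_apply {n : ℕ} {φ : TestSpace d} (hφ : φ ∈ directingSet d (n + 1)) (τ : 𝓓(Ω, ℂ))
    (t : Vec d) : smear φ τ t = ∫ y, φ y * τ (t - y) := by
  rw [← integral_sub_left_eq_self (fun y => φ y * τ (t - y)) volume t]
  change ∫ x, τ x * reflect φ (t - x) = _
  rw [reflect_eq_self hφ]
  refine integral_congr_ae (Eventually.of_forall fun x => ?_)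
  change τ x * φ (t - x) = φ (t - x) * τ (t - (t - x))
  rw [sub_sub_cancel, mul_comm]

/-- All derivatives of `φ * τ` approximate those of `τ`, uniformly, with the order of
approximation given by the index of the directing set. -/
theorem exists_norm_iteratedFDeriv_smear_sub_le (τ : 𝓓(Ω, ℂ)) {K : Set (Vec d)}
    (hK : IsCompact K) (n k : ℕ) : ∃ M, 0 ≤ M ∧ ∀ φ ∈ directingSet d (n + 1), ∀ t ∈ K,
      ‖iteratedFDeriv ℝ k (fun t => smear φ τ t - τ t) t‖ ≤ M * suppRadius φ ^ (n + 1) := by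
  have hsm : ∀ β : Fin k → Fin d, ContDiff ℝ ∞ (partialDeriv β τ) := fun β =>
    (ContinuousMultilinearMap.apply ℝ (fun _ : Fin k => Vec d) ℂ
      fun j => EuclideanSpace.single (β j) (1 : ℝ)).contDiff.comp
      (τ.contDiff.iteratedFDeriv_right (m := ∞) (mod_cast le_top))
  choose M hM0 hM using fun β => exists_norm_integral_sub_le (hsm β) hK n
  refine ⟨∑ β, M β, Finset.sum_nonneg fun β _ => hM0 β, fun φ hφ t ht => ?_⟩
  refine (norm_iteratedFDeriv_le_sum _ _ _).trans ?_
  rw [Finset.sum_mul]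
  refine Finset.sum_le_sum fun β _ => ?_
  have hτ : ContDiffAt ℝ k τ t := τ.contDiff.contDiffAt.of_le (mod_cast le_top)
  have hσ : ContDiffAt ℝ k (smear φ τ) t :=
    (smear φ τ).contDiff.contDiffAt.of_le (mod_cast le_top)
  have e : partialDeriv β (fun t => smear φ τ t - τ t) t =
      (∫ y, φ y * partialDeriv β τ (t - y)) - partialDeriv β τ t := by
    have hs : (smear φ τ : Vec d → ℂ) = fun t => ∫ y, φ y * τ (t - y) :=
      funext fun t => smear_apply hφ τ t
    rw [partialDeriv, show (fun t => smear φ τ t - τ t) = (smear φ τ : Vec d → ℂ) - τ from rfl,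
      iteratedFDeriv_sub_apply hσ hτ, sub_apply, hs,
      iteratedFDeriv_integral_mul_apply φ.continuous τ.contDiff τ.hasCompactSupport]
    rfl
  rw [e]
  exact hM β φ hφ t ht

end Smearing

section Weak

variable {d : ℕ} [NeZero d] {Ω : Opens (Vec d)}

theorem pairing_regularization (T : ComplexDistribution Ω) (φ : TestSpace d) (τ : 𝓓(Ω, ℂ)) :
    pairing (regularization T φ) τ = T (mulCutoff (cutoffTest Ω φ) (smear φ τ)) := by
  rw [← integral_mul_cutoffConv T (cutoffTest Ω φ) τ.continuous τ.hasCompactSupport (reflect φ)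
    (smear φ τ) (fun t => rfl), pairing]
  rw [← setIntegral_eq_integral_of_forall_compl_eq_zero (s := (Ω : Set (Vec d)))
      (f := fun x => τ x * cutoffConv T (cutoffTest Ω φ) (reflect φ) x) fun x hx => by
    rw [image_eq_zero_of_notMem_tsupport fun h => hx (τ.tsupport_subset h), zero_mul]]
  refine setIntegral_congr_fun Ω.isOpen.measurableSet fun x hx => ?_
  rw [(extendZero_regularization_eventuallyEq T φ hx).self_of_nhds, mul_comm]

/-- In the weak sense, the regularizations of a distribution differ from it only by a negligible
net. -/
theorem eventually_norm_pairing_regularization_sub_lt (U : DirectingUltrafilter d)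
    (T : ComplexDistribution Ω) (τ : 𝓓(Ω, ℂ)) (p : ℕ) :
    ∀ᶠ φ in U.ae, ‖pairing (regularization T φ) τ - T τ‖ < suppRadius φ ^ p := by
  have hτ : IsCompact (tsupport τ) := τ.hasCompactSupport.isCompact
  obtain ⟨δ, hδ, hδΩ⟩ := hτ.exists_cthickening_subset_open Ω.isOpen τ.tsupport_subset
  have hK : IsCompact (Metric.cthickening δ (tsupport τ)) := hτ.cthickening
  obtain ⟨N, C, hC, hT⟩ := exists_norm_apply_le T hK hδΩ
  choose M hM0 hM using fun k => exists_norm_iteratedFDeriv_smear_sub_le τ hK p k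
  let B := ∑ k ∈ Finset.range (N + 1), M k
  filter_upwards [eventually_suppRadius_lt U hδ, eventually_cutoff_eq_one U hK hδΩ,
    U.eventually_mem (p + 1), eventually_const_mul_pow_lt U (C * B) p] with φ h1 h2 h3 h4
  have hR := suppRadius_pos φ
  have hτ0 : ∀ t ∉ Metric.cthickening δ (tsupport τ), τ t = 0 := fun t ht =>
    image_eq_zero_of_notMem_tsupport fun h => ht (Metric.self_subset_cthickening _ h)
  have hσ0 : ∀ t ∉ Metric.cthickening δ (tsupport τ), smear φ τ t = 0 := fun t ht => by
    rw [smear_apply h3]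
    refine integral_eq_zero_of_ae (Eventually.of_forall fun y => ?_)
    change φ y * τ (t - y) = 0
    by_contra h
    have hy := norm_le_suppRadius φ (left_ne_zero_of_mul h)
    refine ht (Metric.mem_cthickening_of_dist_le t (t - y) _ _
      (subset_tsupport _ (right_ne_zero_of_mul h)) ?_)
    rw [dist_eq_norm, sub_sub_cancel]
    exact hy.trans h1.le
  have hB : ∀ k ≤ N, M k ≤ B := fun k hk =>
    Finset.single_le_sum (f := M) (fun k _ => hM0 k) (by simp; omega)
  have hB0 : 0 ≤ B := Finset.sum_nonneg fun k _ => hM0 k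
  rw [pairing_regularization, ← map_sub]
  have hfun : (mulCutoff (cutoffTest Ω φ) (smear φ τ) - τ : 𝓓(Ω, ℂ)) =
      fun t => smear φ τ t - τ t := funext fun t =>
    congrArg (· - τ t) (mulCutoff_apply_of_support h2 hσ0 t)
  refine lt_of_le_of_lt (hT _ (fun t ht => ?_) (B * suppRadius φ ^ (p + 1)) (by positivity)
    fun k hk t ht => ?_) (by rwa [← mul_assoc])
  · rw [hfun]
    change smear φ τ t - τ t = 0
    rw [hσ0 t ht, hτ0 t ht, sub_zero]
  · rw [hfun]
    refine (hM k φ h3 t ht).trans ?_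
    gcongr
    exact hB k hk

/-- Near a compact set, the regularization of a regular distribution is the convolution with `φ` of
any function that agrees with the kernel on a neighbourhood. -/
theorem regularization_schwartzEmbedding_apply {f : Ω → ℂ}
    (hf : LocallyIntegrableOn (extendZero f) (Ω : Set (Vec d))) {K : Set (Vec d)} {δ : ℝ}
    (hδΩ : Metric.cthickening δ K ⊆ Ω) {φ : TestSpace d} (hδ : suppRadius φ ≤ δ)
    (hφ : ∀ t ∈ Metric.cthickening δ K, cutoff Ω φ t = 1) {G : Vec d → ℂ}
    (hG : ∀ t ∈ Metric.cthickening δ K, G t = extendZero f t) {x : Vec d} (hx : x ∈ K)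
    (hxΩ : x ∈ Ω) :
    extendZero (regularization (schwartzEmbedding f hf) φ) x = ∫ y, φ y * G (x - y) := by
  rw [extendZero_of_mem _ hxΩ]
  change pairing f (kernelTest Ω φ x) = _
  have hmem : ∀ t, φ (x - t) ≠ 0 → t ∈ Metric.cthickening δ K := fun t ht => by
    refine Metric.mem_cthickening_of_dist_le t x _ _ hx ?_
    rw [dist_comm, dist_eq_norm]
    exact (norm_le_suppRadius φ ht).trans hδ
  rw [← integral_sub_left_eq_self (fun y => φ y * G (x - y)) volume x, pairing,
    ← setIntegral_eq_integral_of_forall_compl_eq_zero (s := (Ω : Set (Vec d)))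
      (f := fun t => φ (x - t) * G (x - (x - t))) fun t ht => by
      by_contra h
      exact ht (hδΩ (hmem t (left_ne_zero_of_mul h)))]
  refine setIntegral_congr_fun Ω.isOpen.measurableSet fun t _ => ?_
  change extendZero f t * (cutoff Ω φ t * φ (x - t)) = φ (x - t) * G (x - (x - t))
  by_cases h : φ (x - t) = 0
  · simp [h]
  · rw [hφ t (hmem t h), sub_sub_cancel, hG t (hmem t h), one_mul, mul_comm]

/-- The regularizations of a smooth function differ from it by a net that is uniformly negligible
on compact sets. -/
theorem eventually_norm_regularization_ofSmooth_sub_le (U : DirectingUltrafilter d)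
    (f : smoothFunctions Ω) {K : Set (Vec d)} (hK : IsCompact K) (hKΩ : K ⊆ Ω) (p : ℕ) :
    ∀ᶠ φ in U.ae, ∀ x ∈ K,
      ‖extendZero (regularization (ofSmooth f) φ) x - extendZero f.1 x‖ ≤ suppRadius φ ^ p := by
  obtain ⟨δ, hδ, hδΩ⟩ := hK.exists_cthickening_subset_open Ω.isOpen hKΩ
  have hK' : IsCompact (Metric.cthickening δ K) := hK.cthickening
  obtain ⟨G, hG, hGf⟩ := exists_contDiff_eqOn f hK' hδΩ
  obtain ⟨M, hM0, hM⟩ := exists_norm_integral_sub_le hG hK p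
  filter_upwards [eventually_suppRadius_lt U hδ, eventually_cutoff_eq_one U hK' hδΩ,
    U.eventually_mem (p + 1), eventually_const_mul_pow_lt U M p] with φ h1 h2 h3 h4 x hx
  rw [ofSmooth, regularization_schwartzEmbedding_apply _ hδΩ h1.le h2 hGf hx (hKΩ hx),
    ← hGf x (Metric.self_subset_cthickening _ hx)]
  exact (hM φ h3 x hx).trans h4.le

/-- The regularizations of a continuous function converge to it uniformly on compact sets. -/
theorem eventually_norm_regularization_ofContinuous_sub_le (U : DirectingUltrafilter d)
    (g : C(Ω, ℂ)) {K : Set (Vec d)} (hK : IsCompact K) (hKΩ : K ⊆ Ω) {ε : ℝ} (hε : 0 < ε) :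
    ∀ᶠ φ in U.ae, ∀ x ∈ K,
      ‖extendZero (regularization (ofContinuous g) φ) x - extendZero g x‖ ≤ ε := by
  obtain ⟨δ, hδ, hδΩ⟩ := hK.exists_cthickening_subset_open Ω.isOpen hKΩ
  have hK' : IsCompact (Metric.cthickening δ K) := hK.cthickening
  -- a globally continuous function that agrees with `g` near `K`
  obtain ⟨G, hG⟩ := ContinuousMap.exists_restrict_eq (Y := ℂ)
    (s := Metric.cthickening δ K) Metric.isClosed_cthickening
    ⟨_, ((continuousOn_extendZero g).mono hδΩ).domRestrict⟩
  have hGf : ∀ t ∈ Metric.cthickening δ K, G t = extendZero g t := fun t ht =>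
    congrArg (fun F : C(Metric.cthickening δ K, ℂ) => F ⟨t, ht⟩) hG
  obtain ⟨η, hη, hGη⟩ := Metric.uniformContinuousOn_iff.1
    (hK'.uniformContinuousOn_of_continuous G.continuous.continuousOn) (ε / 2) (by positivity)
  filter_upwards [eventually_suppRadius_lt U hδ, eventually_suppRadius_lt U hη,
    eventually_cutoff_eq_one U hK' hδΩ, U.eventually_mem 1] with φ h1 h2 h3 h4 x hx
  have hxK := Metric.self_subset_cthickening (δ := δ) K hx
  rw [ofContinuous, regularization_schwartzEmbedding_apply _ hδΩ h1.le h3 hGf hx (hKΩ hx),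
    ← hGf x hxK]
  have hφi : Integrable (φ : Vec d → ℂ) :=
    φ.continuous.integrable_of_hasCompactSupport φ.hasCompactSupport
  have e : (∫ y, φ y * G (x - y)) - G x = ∫ y, (G (x - y) - G x) * φ y := by
    have hx1 : G x = ∫ y, G x * φ y := by rw [integral_const_mul, h4.2.2.2.1, mul_one]
    trans (∫ y, φ y * G (x - y)) - ∫ y, G x * φ y
    · rw [← hx1]
    rw [← integral_sub _ (hφi.const_mul _)]
    · refine integral_congr_ae (Eventually.of_forall fun y => ?_)
      change φ y * G (x - y) - G x * φ y = (G (x - y) - G x) * φ y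
      ring
    · simpa only [mul_comm] using integrable_mul_testFunction φ
        (f := fun y => G (x - y)) (G.continuous.comp (continuous_const.sub continuous_id))
  rw [e]
  calc ‖∫ y, (G (x - y) - G x) * φ y‖ ≤ ∫ y, ε / 2 * ‖φ y‖ := by
        refine norm_integral_le_of_norm_le (hφi.norm.const_mul _)
          (Eventually.of_forall fun y => ?_)
        rw [norm_mul]
        by_cases hy : φ y = 0
        · simp [hy]
        · have hy' := norm_le_suppRadius φ hy
          have hd : dist (x - y) x = ‖y‖ := by rw [dist_eq_norm, sub_sub_cancel_left, norm_neg]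
          refine mul_le_mul_of_nonneg_right ?_ (norm_nonneg _)
          rw [← dist_eq_norm]
          refine (hGη _ (Metric.mem_cthickening_of_dist_le _ x _ _ hx ?_) _ hxK ?_).le
          · rw [hd]; exact hy'.trans h1.le
          · rw [hd]; exact hy'.trans_lt h2
    _ = ε / 2 * ∫ y, ‖φ y‖ := integral_const_mul _ _
    _ ≤ ε / 2 * 2 := by
        gcongr
        exact integral_norm_le_two h4
    _ = ε := by ring

end Weak

/-! ### Asymptotic numbers and products -/

section Quotients

variable {d : ℕ} [NeZero d] {U : DirectingUltrafilter d} {Ω : Opens (Vec d)}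

theorem AsymptoticFunction.pairing_mk_eq_of_eventually (A B : moderateFunctions U Ω)
    (τ : 𝓓(Ω, ℂ)) (h : ∀ p : ℕ, ∀ᶠ φ in U.ae,
      ‖AsymptoticFunctions.pairing (A.1 φ).1 τ - AsymptoticFunctions.pairing (B.1 φ).1 τ‖ <
        suppRadius φ ^ p) :
    AsymptoticFunction.pairing τ (Ideal.Quotient.mk (negligibleFunctions U Ω) A) =
      AsymptoticFunction.pairing τ (Ideal.Quotient.mk (negligibleFunctions U Ω) B) :=
  Ideal.Quotient.eq.2 h

theorem AsymptoticNumber.isInfinitesimal_mk (z : moderateNumbers U ℂ)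
    (h : ∀ ε > 0, ∀ᶠ φ in U.ae, ‖z.1 φ‖ ≤ ε) :
    AsymptoticNumber.IsInfinitesimal (Ideal.Quotient.mk (negligibleNumbers U ℂ) z) := by
  intro n hn
  have hn' : (0 : ℝ) < 1 / (n : ℝ) := by positivity
  let A : moderateNumbers U ℝ := ⟨fun φ => ‖z.1 φ‖, by
    obtain ⟨m, hm⟩ := z.2
    exact ⟨m, by simpa using hm⟩⟩
  let c : moderateNumbers U ℝ := ⟨fun _ => 1 / (n : ℝ), by
    refine ⟨1, ?_⟩
    filter_upwards [eventually_const_mul_inv_pow_le U ‖1 / (n : ℝ)‖ 0] with φ h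
    simpa using h⟩
  have hhalf := h (1 / (n : ℝ) / 2) (by positivity)
  refine ⟨fun h0 => ?_, c - A, rfl, ?_⟩
  · have hneg : c - A ∈ negligibleNumbers U ℝ := Ideal.Quotient.eq_zero_iff_mem.1 h0
    obtain ⟨φ, h1, h2, h3⟩ := ((hneg 1).and (hhalf.and
      (eventually_suppRadius_lt U (half_pos hn')))).exists
    have h4 : 1 / (n : ℝ) - ‖z.1 φ‖ < suppRadius φ ^ 1 := (le_abs_self _).trans_lt h1
    rw [pow_one] at h4
    linarith
  · filter_upwards [hhalf] with φ h1
    change 0 < 1 / (n : ℝ) - ‖z.1 φ‖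
    linarith

theorem AsymptoticFunction.pairing_mk_sub_isInfinitesimal (A B : moderateFunctions U Ω)
    (τ : 𝓓(Ω, ℂ)) (h : ∀ ε > 0, ∀ᶠ φ in U.ae,
      ‖AsymptoticFunctions.pairing (A.1 φ).1 τ - AsymptoticFunctions.pairing (B.1 φ).1 τ‖ ≤ ε) :
    (AsymptoticFunction.pairing τ (Ideal.Quotient.mk (negligibleFunctions U Ω) A) -
      AsymptoticFunction.pairing τ
        (Ideal.Quotient.mk (negligibleFunctions U Ω) B)).IsInfinitesimal :=
  AsymptoticNumber.isInfinitesimal_mk (_ - _) h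

end Quotients

section Products

variable {d : ℕ} {Ω : Opens (Vec d)}

theorem pairing_sub (f g : smoothFunctions Ω) (τ : 𝓓(Ω, ℂ)) :
    pairing (f - g).1 τ = pairing f.1 τ - pairing g.1 τ := by
  rw [pairing, pairing, pairing, ← integral_sub (integrableOn_extendZero_mul f τ)
    (integrableOn_extendZero_mul g τ), show extendZero (f - g).1 = extendZero f.1 - extendZero g.1
      from extendZero_sub _ _]
  simp only [Pi.sub_apply, sub_mul]

theorem pairing_mul_eq_pairing_mulTest (f g : smoothFunctions Ω) (τ : 𝓓(Ω, ℂ)) :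
    pairing (f * g).1 τ = pairing g.1 (mulTest f τ) := by
  rw [pairing, pairing, show extendZero (f * g).1 = extendZero f.1 * extendZero g.1
    from extendZero_mul _ _]
  refine integral_congr_ae (Eventually.of_forall fun x => ?_)
  change extendZero f.1 x * extendZero g.1 x * τ x = extendZero g.1 x * (τ x * extendZero f.1 x)
  ring

variable [NeZero d]

/-- The regularization of a distribution, as a smooth function. -/
def smoothRegularization (T : ComplexDistribution Ω) (φ : TestSpace d) : smoothFunctions Ω :=
  ⟨regularization T φ, regularization_mem_smoothFunctions T φ⟩

/-- Regularizing the smooth factor of a product only changes the pairing by a negligible net,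
because the other factor is moderate. -/
theorem eventually_norm_pairing_ofSmooth_mul_sub_lt (U : DirectingUltrafilter d)
    (T : ComplexDistribution Ω) (f : smoothFunctions Ω) (τ : 𝓓(Ω, ℂ)) (p : ℕ) :
    ∀ᶠ φ in U.ae,
      ‖pairing (smoothRegularization (ofSmooth f) φ * smoothRegularization T φ).1 τ -
        pairing (smoothRegularization T φ).1 (mulTest f τ)‖ < suppRadius φ ^ p := by
  have hτ : IsCompact (tsupport τ) := τ.hasCompactSupport.isCompact
  obtain ⟨m, hm⟩ := (isModerate_regularization U T).2 _ hτ τ.tsupport_subset 0 ![]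
  filter_upwards [hm, eventually_norm_regularization_ofSmooth_sub_le U f hτ τ.tsupport_subset
    (p + 1 + m), eventually_const_mul_pow_lt U (∫ x in (Ω : Set (Vec d)), ‖τ x‖) p] with φ h1 h2 h3
  have hR := suppRadius_pos φ
  rw [← pairing_mul_eq_pairing_mulTest, ← pairing_sub, ← sub_mul]
  refine ((norm_pairing_le τ (C := suppRadius φ ^ (p + 1)) fun x hx => ?_).trans_eq
    (mul_comm _ _)).trans_lt h3
  rw [show extendZero ((smoothRegularization (ofSmooth f) φ - f) * smoothRegularization T φ).1 =
      (extendZero (regularization (ofSmooth f) φ) - extendZero f.1) *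
        extendZero (regularization T φ) from
      (extendZero_mul _ _).trans (congrArg (· * _) (extendZero_sub _ _)),
    Pi.mul_apply, Pi.sub_apply, norm_mul]
  have h1' := h1 x hx
  rw [partialDeriv_zero] at h1'
  calc _ ≤ suppRadius φ ^ (p + 1 + m) * (suppRadius φ ^ m)⁻¹ := by
        gcongr
        exact h2 x hx
    _ = suppRadius φ ^ (p + 1) := by
        rw [pow_add]
        field_simp

/-- Products of regularizations of continuous functions converge to the product, uniformly on
compact sets. -/
theorem eventually_norm_ofContinuous_mul_sub_le (U : DirectingUltrafilter d) (g k : C(Ω, ℂ))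
    {K : Set (Vec d)} (hK : IsCompact K) (hKΩ : K ⊆ Ω) {ε : ℝ} (hε : 0 < ε) :
    ∀ᶠ φ in U.ae, ∀ x ∈ K,
      ‖extendZero (regularization (ofContinuous g) φ) x *
        extendZero (regularization (ofContinuous k) φ) x -
          extendZero (regularization (ofContinuous (g * k)) φ) x‖ ≤ ε := by
  obtain ⟨B, hB⟩ := hK.exists_bound_of_continuousOn ((continuousOn_extendZero g).mono hKΩ)
  obtain ⟨C, hC⟩ := hK.exists_bound_of_continuousOn ((continuousOn_extendZero k).mono hKΩ)
  -- with error `η ≤ 1` in each factor the total error is at most `η (|B| + |C| + 2)`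
  let η := min 1 (ε / (|B| + |C| + 2))
  have hη : 0 < η := lt_min one_pos (by positivity)
  have hη1 : η ≤ 1 := min_le_left _ _
  have hηε : η * (|B| + |C| + 2) ≤ ε := by
    rw [← le_div_iff₀ (by positivity)]
    exact min_le_right _ _
  filter_upwards [eventually_norm_regularization_ofContinuous_sub_le U g hK hKΩ hη,
    eventually_norm_regularization_ofContinuous_sub_le U k hK hKΩ hη,
    eventually_norm_regularization_ofContinuous_sub_le U (g * k) hK hKΩ hη]
    with φ h1 h2 h3 x hx
  have e : extendZero (g * k : C(Ω, ℂ)) x = extendZero g x * extendZero k x :=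
    congrFun (extendZero_mul (g : Ω → ℂ) k) x
  have h1' := h1 x hx
  have h2' := h2 x hx
  have h3' := h3 x hx
  rw [e] at h3'
  set a := extendZero g x
  set b := extendZero k x
  set a' := extendZero (regularization (ofContinuous g) φ) x
  set b' := extendZero (regularization (ofContinuous k) φ) x
  set c' := extendZero (regularization (ofContinuous (g * k)) φ) x
  have ha : ‖a‖ ≤ |B| := (hB x hx).trans (le_abs_self B)
  have hb : ‖b‖ ≤ |C| := (hC x hx).trans (le_abs_self C)
  have hdec : a' * b' - c' = (a' - a) * (b' - b) + (a' - a) * b + a * (b' - b) - (c' - a * b) := by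
    ring
  calc ‖a' * b' - c'‖
      ≤ ‖a' - a‖ * ‖b' - b‖ + ‖a' - a‖ * ‖b‖ + ‖a‖ * ‖b' - b‖ + ‖c' - a * b‖ := by
        rw [hdec]
        refine (norm_sub_le _ _).trans (add_le_add (norm_add₃_le.trans_eq ?_) le_rfl)
        simp only [norm_mul]
    _ ≤ η * 1 + η * |C| + |B| * η + η := by
        gcongr
        exact h2'.trans hη1
    _ = η * (|B| + |C| + 2) := by ring
    _ ≤ ε := hηε

theorem eventually_norm_pairing_ofContinuous_mul_sub_le (U : DirectingUltrafilter d)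
    (g k : C(Ω, ℂ)) (τ : 𝓓(Ω, ℂ)) {ε : ℝ} (hε : 0 < ε) :
    ∀ᶠ φ in U.ae,
      ‖pairing (smoothRegularization (ofContinuous g) φ *
          smoothRegularization (ofContinuous k) φ).1 τ -
        pairing (smoothRegularization (ofContinuous (g * k)) φ).1 τ‖ ≤ ε := by
  let I := ∫ x in (Ω : Set (Vec d)), ‖τ x‖
  have hI : 0 ≤ I := integral_nonneg fun x => norm_nonneg _
  filter_upwards [eventually_norm_ofContinuous_mul_sub_le U g k τ.hasCompactSupport.isCompact
    τ.tsupport_subset (ε := ε / (I + 1)) (by positivity)] with φ h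
  rw [← pairing_sub]
  refine (norm_pairing_le τ (C := ε / (I + 1)) fun x hx => ?_).trans ?_
  · rw [show extendZero (smoothRegularization (ofContinuous g) φ *
        smoothRegularization (ofContinuous k) φ -
          smoothRegularization (ofContinuous (g * k)) φ).1 =
        extendZero (regularization (ofContinuous g) φ) *
          extendZero (regularization (ofContinuous k) φ) -
            extendZero (regularization (ofContinuous (g * k)) φ) from
      (extendZero_sub _ _).trans (congrArg (· - _) (extendZero_mul _ _))]
    exact h x hx
  · change ε / (I + 1) * I ≤ ε
    rw [div_mul_eq_mul_div, div_le_iff₀ (by positivity)]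
    nlinarith

end Products

end AsymptoticFunctions

open AsymptoticFunctions

theorem theorem5p4 {d : ℕ} [NeZero d] (U : DirectingUltrafilter d) (Ω : TopologicalSpace.Opens (Vec d)) :
    ∃ h : ∀ T : ComplexDistribution Ω, IsModerate U Ω (regularization T),
      (∀ (T : ComplexDistribution Ω) (f : smoothFunctions Ω),
        (distributionalEmbedding h (ofSmooth f) * distributionalEmbedding h T).WeaklyEqual
          (distributionalEmbedding h (smoothMul f T))) ∧
      (∀ g k : C(Ω, ℂ),
        (distributionalEmbedding h (ofContinuous g) *
            distributionalEmbedding h (ofContinuous k)).Associated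
          (distributionalEmbedding h (ofContinuous (g * k)))) := by
  let net : ComplexDistribution Ω → moderateFunctions U Ω := fun T =>
    ⟨smoothRegularization T, isModerate_regularization U T⟩
  refine ⟨isModerate_regularization U, fun T f τ => ?_, fun g k τ => ?_⟩
  · refine AsymptoticFunction.pairing_mk_eq_of_eventually (net (ofSmooth f) * net T)
      (net (smoothMul f T)) τ fun p => ?_
    -- both sides are compared with `(T | f τ)`
    filter_upwards [eventually_norm_pairing_ofSmooth_mul_sub_lt U T f τ (p + 1),
      eventually_norm_pairing_regularization_sub_lt U T (mulTest f τ) (p + 1),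
      eventually_norm_pairing_regularization_sub_lt U (smoothMul f T) τ (p + 1),
      eventually_const_mul_pow_lt U 3 p] with φ h1 h2 h3 h4
    rw [smoothMul_apply] at h3
    change ‖pairing (smoothRegularization (ofSmooth f) φ * smoothRegularization T φ).1 τ -
      pairing (regularization (smoothMul f T) φ) τ‖ < _
    have h5 := norm_sub_le_norm_sub_add_norm_sub
      (pairing (smoothRegularization (ofSmooth f) φ * smoothRegularization T φ).1 τ)
      (pairing (regularization T φ) (mulTest f τ)) (pairing (regularization (smoothMul f T) φ) τ)
    have h6 := norm_sub_le_norm_sub_add_norm_sub (pairing (regularization T φ) (mulTest f τ))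
      (T (mulTest f τ)) (pairing (regularization (smoothMul f T) φ) τ)
    rw [norm_sub_rev (T (mulTest f τ))] at h6
    change ‖_ - pairing (regularization T φ) (mulTest f τ)‖ < _ at h1
    linarith
  · exact AsymptoticFunction.pairing_mk_sub_isInfinitesimal
      (net (ofContinuous g) * net (ofContinuous k)) (net (ofContinuous (g * k))) τ
      fun ε hε => eventually_norm_pairing_ofContinuous_mul_sub_le U g k τ hε
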